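/- Let $n\ge 1$ and let $q,p_1,\dots,p_{n-1}$ be positive integers with $p_i<q$ and $\gcd(p_i,q)=1$ for all $i$. Let $C=C(q;p_1,\dots,p_{n-1})=\operatorname{Cone}(v_1,\dots,v_n)$ be the simplicial cone in $V=\mathbb R^n$ with ordered generators $v_i=e_i$ for $1\le i\le n-1$ and $v_n=(p_1,\dots,p_{n-1},q)$, and let $B=\{v_1,\dots,v_n\}$. Let $M_C$ be the matrix with columns $v_1,\dots,v_n$ (so $\det M_C=q$), let $\Gamma_C=\mathbb Z^n/\sum_i\mathbb Z v_i$, and let $\chi_j(\gamma)=e^{2\pi i a_j}$ if $\gamma$ is the class of $\sum_j a_jv_j\in\mathbb Z^n$. For $N\ge 0$ let $\operatorname{Todd}_C^N(x_1,\dots,x_n)$ be the homogeneous part of total degree $N$ of the Taylor series at $0$ of $$\operatorname{Todd}_C(x_1,\dots,x_n)=\sum_{\gamma\in\Gamma_C}\prod_{j=1}^n\frac{x_j}{1-\chi_j(\gamma)e^{-x_j}}.$$ Let $S^N(C)$ be the rational function on $V$ $$S^N(C)=\frac{\operatorname{Todd}_C^N(v_1^*,\dots,v_n^*)}{(\det M_C)\,v_1^*\cdots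 v_n^*},$$ where $v_1^*,\dots,v_n^*$ is the basis of $V^*$ dual to $v_1,\dots,v_n$, and let $S^N(C)_B$ be this function written in the coordinates $x_1,\dots,x_n$ with respect to $B$. Finally let $d_{N,n}$ be the least common multiple of the denominators of the coefficients of the homogeneous part of total degree $N$ of $\prod_{i=1}^n \frac{x_i}{1-e^{-x_i}}$. Then for every integer $N\ge 0$ $$\operatorname{Todd}_C^N(x_1,\dots,x_n)=q\,x_1\cdots x_n\,S^N(C)_B\;\in\;\frac1{d_{N,n}}\,\mathbb Z[x_1,\dots,x_n].$$ -/

import Mathlib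

noncomputable section

namespace ToddCone

/-! ### The one-variable series -/

section OneVariable

variable {K : Type*} [Field K] [Algebra ℚ K]

/-- The power series `1 - c * exp (-X)`. -/
def oneSubMulExpNeg (c : K) : PowerSeries K :=
  1 - PowerSeries.C c * PowerSeries.evalNegHom (PowerSeries.exp K)

open Classical in
/-- The Taylor series at `0` of `x / (1 - c * exp (-x))`.  For `c ≠ 1` the denominator is
invertible as a power series; for `c = 1` it is `x` times an invertible power series, and the
common factor `x` is cancelled.  See `toddFactor_mul` for the characterizing identity. -/
def toddFactor (c : K) : PowerSeries K :=
  if c = 1 then (PowerSeries.mk fun k => PowerSeries.coeff (k + 1) (oneSubMulExpNeg c))⁻¹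
  else PowerSeries.X * (oneSubMulExpNeg c)⁻¹

theorem toddFactor_mul (c : K) : toddFactor c * oneSubMulExpNeg c = PowerSeries.X := by
  have h0 : PowerSeries.constantCoeff (oneSubMulExpNeg c) = 1 - c := by
    simp [oneSubMulExpNeg, PowerSeries.evalNegHom, ← PowerSeries.coeff_zero_eq_constantCoeff_apply,
      PowerSeries.coeff_rescale, -PowerSeries.coeff_zero_eq_constantCoeff]
  unfold toddFactor
  split_ifs with hc
  · have h1 : PowerSeries.constantCoeff
        (PowerSeries.mk fun k => PowerSeries.coeff (k + 1) (oneSubMulExpNeg c)) ≠ 0 := by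
      subst hc
      simp [oneSubMulExpNeg, PowerSeries.evalNegHom, PowerSeries.coeff_rescale,
        PowerSeries.coeff_exp, ← PowerSeries.coeff_zero_eq_constantCoeff_apply,
        PowerSeries.coeff_one]
    have h2 := PowerSeries.eq_X_mul_shift_add_const (oneSubMulExpNeg c)
    rw [h0, hc, sub_self, map_zero, add_zero] at h2
    rw [hc] at h1
    rw [hc]
    generalize oneSubMulExpNeg (1 : K) = f at h1 h2
    generalize (PowerSeries.mk fun k => PowerSeries.coeff (k + 1) f) = g at h1 h2
    rw [h2, mul_left_comm, PowerSeries.inv_mul_cancel _ h1, mul_one]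
  · rw [mul_assoc, PowerSeries.inv_mul_cancel, mul_one]
    rw [h0]
    exact sub_ne_zero.mpr (Ne.symm hc)

end OneVariable

/-! ### Homogeneous parts and the constants `d_{N,n}` -/

/-- The homogeneous part of total degree `N` of a power series in `n` variables, as a polynomial. -/
def homogPart {K : Type*} [CommSemiring K] {n : ℕ} (f : MvPowerSeries (Fin n) K) (N : ℕ) :
    MvPolynomial (Fin n) K :=
  ∑ r ∈ Finset.finsuppAntidiag Finset.univ N, MvPolynomial.monomial r (MvPowerSeries.coeff r f)

/-- The Todd power series in `n` variables `∏ i, x_i / (1 - exp (-x_i))`. -/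
def stdTodd (n : ℕ) : MvPowerSeries (Fin n) ℚ :=
  ∏ i : Fin n, PowerSeries.subst (MvPowerSeries.X i : MvPowerSeries (Fin n) ℚ) (toddFactor (1 : ℚ))

/-- `d_{N,n}`: the least common multiple of the denominators of the coefficients of the
`N`-th Todd polynomial in `n` variables. -/
def toddDenom (N n : ℕ) : ℕ :=
  (homogPart (stdTodd n) N).support.lcm fun r =>
    (MvPolynomial.coeff r (homogPart (stdTodd n) N)).den

/-! ### Cones -/

/-- A nondegenerate `n`-simplicial cone in `ℝⁿ`: an ordered `n`-tuple of linearly independent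
vectors of `ℤⁿ`. -/
structure SimplicialCone (n : ℕ) where
  /-- The ordered generators `v_1, …, v_n`. -/
  gen : Fin n → Fin n → ℤ
  det_ne_zero : (Matrix.of fun k i => gen i k).det ≠ 0

namespace SimplicialCone

variable {n : ℕ} (C : SimplicialCone n)

/-- The matrix `M_C` whose columns are the generators. -/
def M : Matrix (Fin n) (Fin n) ℤ := Matrix.of fun k i => C.gen i k

/-- The matrix `M_C` with complex entries. -/
def MC : Matrix (Fin n) (Fin n) ℂ := C.M.map (Int.cast : ℤ → ℂ)

theorem det_MC : C.MC.det = (C.M.det : ℂ) :=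
  (Int.cast_det (R := ℂ) C.M).symm

theorem det_MC_ne_zero : C.MC.det ≠ 0 := by
  rw [det_MC]
  exact_mod_cast C.det_ne_zero

/-- The sublattice `Λ_C` of `ℤⁿ` spanned by the generators. -/
def lattice : Submodule ℤ (Fin n → ℤ) := Submodule.span ℤ (Set.range C.gen)

/-- The quotient group `Γ_C = ℤⁿ / Λ_C`. -/
abbrev Gamma : Type := (Fin n → ℤ) ⧸ C.lattice

/-- The `j`-th coordinate `a_j` of `v = ∑ j, a_j v_j` with respect to the generators. -/
def coord (j : Fin n) : (Fin n → ℤ) →ₗ[ℤ] ℂ where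
  toFun v := C.MC⁻¹.mulVec (fun k => (v k : ℂ)) j
  map_add' u v := by
    have : (fun k => (((u + v) k : ℤ) : ℂ)) = (fun k => (u k : ℂ)) + fun k => (v k : ℂ) := by
      ext k; simp
    rw [this, Matrix.mulVec_add, Pi.add_apply]
  map_smul' a v := by
    have : (fun k => (((a • v) k : ℤ) : ℂ)) = (a : ℂ) • fun k => (v k : ℂ) := by
      ext k; simp
    rw [this, Matrix.mulVec_smul]
    simp

theorem coord_gen (i j : Fin n) : C.coord j (C.gen i) = if j = i then 1 else 0 := by
  have h : C.MC⁻¹ * C.MC = 1 :=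
    Matrix.nonsing_inv_mul _ (isUnit_iff_ne_zero.mpr C.det_MC_ne_zero)
  have h2 := congrFun (congrFun h j) i
  rw [Matrix.one_apply, Matrix.mul_apply] at h2
  rw [← h2]
  rfl

theorem coord_mem {v : Fin n → ℤ} (hv : v ∈ C.lattice) (j : Fin n) :
    ∃ a : ℤ, C.coord j v = a := by
  induction hv using Submodule.span_induction with
  | mem x hx =>
    obtain ⟨i, rfl⟩ := hx
    refine ⟨if j = i then 1 else 0, ?_⟩
    rw [coord_gen]
    split_ifs <;> simp
  | zero => exact ⟨0, by simp⟩
  | add x y _ _ hx hy =>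
    obtain ⟨a, ha⟩ := hx
    obtain ⟨b, hb⟩ := hy
    exact ⟨a + b, by simp [ha, hb]⟩
  | smul c x _ hx =>
    obtain ⟨a, ha⟩ := hx
    exact ⟨c * a, by rw [map_smul, ha]; simp⟩

/-- The character `χ_j` on `Γ_C`: the class of `v = ∑ j, a_j v_j` is sent to `exp (2πi a_j)`. -/
def char (j : Fin n) : C.Gamma → ℂ :=
  Quotient.lift (fun v : Fin n → ℤ => Complex.exp (2 * Real.pi * Complex.I * C.coord j v)) <| by
    intro u v huv
    have huv' : u - v ∈ C.lattice := (Submodule.quotientRel_def C.lattice).mp huv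
    obtain ⟨a, ha⟩ := C.coord_mem huv' j
    rw [map_sub, sub_eq_iff_eq_add] at ha
    refine Complex.exp_eq_exp_iff_exists_int.mpr ⟨a, ?_⟩
    rw [ha]
    ring

theorem linearIndependent_gen : LinearIndependent ℤ C.gen := by
  have h : (Matrix.of fun i k => C.gen i k).det ≠ 0 := by
    rw [← Matrix.det_transpose]
    exact C.det_ne_zero
  exact Matrix.linearIndependent_rows_of_det_ne_zero h

instance finite_Gamma : Finite C.Gamma := by
  apply Submodule.finiteQuotientOfFreeOfRankEq
  rw [lattice, finrank_span_eq_card C.linearIndependent_gen]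
  simp

instance fintype_Gamma : Fintype C.Gamma := Fintype.ofFinite _

/-- The Taylor series at `0` of the Todd series
`Todd_C(x_1, …, x_n) = ∑ γ ∈ Γ_C, ∏ i, x_i / (1 - χ_i(γ) exp (-x_i))`. -/
def todd : MvPowerSeries (Fin n) ℂ :=
  ∑ γ : C.Gamma, ∏ i : Fin n,
    PowerSeries.subst (MvPowerSeries.X i : MvPowerSeries (Fin n) ℂ) (toddFactor (C.char i γ))

/-- The `N`-th Todd polynomial `Todd_C^N` of `C`. -/
def toddPoly (N : ℕ) : MvPolynomial (Fin n) ℂ := homogPart C.todd N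

/-! ### Rational functions on `V`

Polynomial and rational functions on `V = ℝⁿ` are written in the coordinates `y_1, …, y_n` with
respect to the standard basis; the variables `X k` below are these `y_k`. -/

/-- The linear function `v_i^*` on `V`, the `i`-th element of the basis dual to the generators. -/
def dualGen (i : Fin n) : MvPolynomial (Fin n) ℂ :=
  ∑ k, MvPolynomial.C (C.MC⁻¹ i k) * MvPolynomial.X k

/-- The polynomial function `T^N(C) = Todd_C^N(v_1^*, …, v_n^*)` on `V`. -/
def T (N : ℕ) : MvPolynomial (Fin n) ℂ := MvPolynomial.aeval C.dualGen (C.toddPoly N)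

/-- The rational function `S^N(C) = T^N(C) / (det M_C · v_1^* ⋯ v_n^*)` on `V`. -/
def S (N : ℕ) : FractionRing (MvPolynomial (Fin n) ℂ) :=
  algebraMap _ _ (C.T N) /
    algebraMap _ _ (MvPolynomial.C (C.M.det : ℂ) * ∏ i, C.dualGen i)

/-- A polynomial function on `V` rewritten in the coordinates `x_1, …, x_n` with respect to the
ordered basis `B = {v_1, …, v_n}` of generators of `C`: substitute `y = ∑ i, x_i v_i`. -/
def polyInBasis : MvPolynomial (Fin n) ℂ →ₐ[ℂ] MvPolynomial (Fin n) ℂ :=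
  MvPolynomial.aeval fun k => ∑ i, MvPolynomial.C ((C.gen i k : ℤ) : ℂ) * MvPolynomial.X i

theorem polyInBasis_injective : Function.Injective C.polyInBasis := by
  have h : C.MC * C.MC⁻¹ = 1 :=
    Matrix.mul_nonsing_inv _ (isUnit_iff_ne_zero.mpr C.det_MC_ne_zero)
  have key : (MvPolynomial.aeval C.dualGen).comp C.polyInBasis = AlgHom.id ℂ _ := by
    apply MvPolynomial.algHom_ext
    intro k
    have h2 : ∀ l, ∑ i, ((C.gen i k : ℤ) : ℂ) * C.MC⁻¹ i l = if k = l then 1 else 0 := by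
      intro l
      have := congrFun (congrFun h k) l
      rw [Matrix.one_apply, Matrix.mul_apply] at this
      rw [← this]
      rfl
    simp only [AlgHom.comp_apply, polyInBasis, MvPolynomial.aeval_X, map_sum, map_mul,
      MvPolynomial.aeval_C, MvPolynomial.algebraMap_eq, dualGen, Finset.mul_sum, AlgHom.id_apply]
    rw [Finset.sum_comm]
    simp only [← mul_assoc, ← map_mul, ← Finset.sum_mul, ← map_sum, h2]
    simp
  intro f g hfg
  have h3 : ∀ f, MvPolynomial.aeval C.dualGen (C.polyInBasis f) = f := fun f =>
    DFunLike.congr_fun key f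
  rw [← h3 f, hfg, h3 g]

/-- A rational function `f` on `V` rewritten in the coordinates `x_1, …, x_n` with respect to the
ordered basis `B = {v_1, …, v_n}` of generators of `C`; this is `f_B`. -/
def inBasis : FractionRing (MvPolynomial (Fin n) ℂ) →+* FractionRing (MvPolynomial (Fin n) ℂ) :=
  IsFractionRing.map (A := MvPolynomial (Fin n) ℂ) (B := MvPolynomial (Fin n) ℂ)
    (j := C.polyInBasis.toRingHom) C.polyInBasis_injective

end SimplicialCone

/-! ### The cone `C(q; p_1, …, p_{n-1})` with `n = m + 1` -/

/-- The generators `v_i = e_i` for `i < n` and `v_n = (p_1, …, p_{n-1}, q)`, with `n = m + 1`. -/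
def dedekindGen {m : ℕ} (q : ℕ) (p : Fin m → ℕ) : Fin (m + 1) → Fin (m + 1) → ℤ :=
  Fin.snoc (α := fun _ => Fin (m + 1) → ℤ) (fun i : Fin m => Pi.single i.castSucc 1)
    (Fin.snoc (α := fun _ => ℤ) (fun i => (p i : ℤ)) (q : ℤ))

theorem det_dedekindGen {m : ℕ} (q : ℕ) (p : Fin m → ℕ) :
    (Matrix.of fun k i => dedekindGen q p i k).det = (q : ℤ) := by
  rw [Matrix.det_of_isUpperTriangular, Fin.prod_univ_castSucc]
  · simp [dedekindGen]
  · intro k i hik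
    simp only [id] at hik
    induction i using Fin.lastCases with
    | last => exact absurd (Fin.le_last k) (not_le.mpr hik)
    | cast i => simp [dedekindGen, hik.ne']

/-- The cone `C(q; p_1, …, p_{n-1})`, with `n = m + 1`. -/
def dedekindCone {m : ℕ} (q : ℕ) (hq : 0 < q) (p : Fin m → ℕ) : SimplicialCone (m + 1) where
  gen := dedekindGen q p
  det_ne_zero := by
    rw [det_dedekindGen]
    exact_mod_cast hq.ne'

end ToddCone

end

/-!
Summing the characters over `Γ_C` turns the Todd series of `C` at `x`, divided by
`q * ∏ j, x j`, into the generating function `∑ exp (-⟨m, v⟩)` of the lattice points `m` of the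
dual cone, where `v = ∑ i, x i • v_i`. Star subdivision of `C` down to unimodular cones writes the
indicator function of the dual cone as an integral combination of indicator functions of duals of
unimodular cones, up to functions with a nonzero period, whose generating functions vanish.
Comparing Laurent coefficients in `t` after scaling `x` by `t`, the polynomial `Todd_C^N` becomes an
integral combination of terms `q * ∏ j, x j * Todd^N(ℓ_1, …, ℓ_n) / ∏ j, ℓ_j`, where the linear
forms `ℓ_j` are given by the columns of an integral matrix of determinant `± q`. The product of the
contents of the `ℓ_j` divides `q`, so after multiplication by `d_{N,n}` only primitive denominators
remain; by Gauss's lemma a polynomial that is such a quotient has integral coefficients.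
-/

noncomputable section

open Matrix

namespace ToddCone

section Decomposition

variable (R : Type*) [CommRing R] {ι : Type*} [Fintype ι]

/-- The functions on an abelian group that are sums of functions with a nonzero period. Their
generating functions vanish, so they are what one computes modulo. -/
def periodicSpan (G : Type*) [AddCommGroup G] : AddSubgroup (G → R) :=
  AddSubgroup.closure {f | ∃ u : G, u ≠ 0 ∧ Function.Periodic f u}

/-- The indicator function of the lattice points of the dual of the cone generated by the rows
of `V`. -/
def dualConeInd (V : Matrix ι ι ℤ) (m : ι → ℤ) : R := if ∀ i, 0 ≤ V i ⬝ᵥ m then 1 else 0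

/-- The indicator function of the lattice points of the half-space dual to `u`. -/
def halfSpaceInd (u m : ι → ℤ) : R := if 0 ≤ u ⬝ᵥ m then 1 else 0

theorem dualConeInd_eq_prod (V : Matrix ι ι ℤ) (m : ι → ℤ) :
    dualConeInd R V m = ∏ i, halfSpaceInd R (V i) m := by
  simp only [halfSpaceInd, Finset.prod_ite_zero, Finset.prod_const_one, Finset.mem_univ,
    true_imp_iff, dualConeInd]

variable {R}

theorem exists_ne_zero_forall_dotProduct_eq_zero (s : Finset (ι → ℤ))
    (hs : s.card < Fintype.card ι) : ∃ u : ι → ℤ, u ≠ 0 ∧ ∀ v ∈ s, v ⬝ᵥ u = 0 := by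
  have hinj : ¬ Function.Injective (Matrix.mulVecLin (Matrix.of fun v : s => v.1)) := fun h =>
    hs.not_ge ((card_le_of_injective ℤ _ h).trans_eq (Fintype.card_coe s))
  rw [← LinearMap.ker_eq_bot, Submodule.eq_bot_iff] at hinj
  push Not at hinj
  obtain ⟨u, hu, hu0⟩ := hinj
  exact ⟨u, hu0, fun v hv => congrFun (LinearMap.mem_ker.1 hu) ⟨v, hv⟩⟩

theorem mem_periodicSpan_of_card_lt {f : (ι → ℤ) → R} {s : Finset (ι → ℤ)}
    (hs : s.card < Fintype.card ι)
    (hf : ∀ m m', (∀ v ∈ s, v ⬝ᵥ m = v ⬝ᵥ m') → f m = f m') : f ∈ periodicSpan R (ι → ℤ) := by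
  obtain ⟨u, hu0, hu⟩ := exists_ne_zero_forall_dotProduct_eq_zero s hs
  refine AddSubgroup.subset_closure ⟨u, hu0, fun m => hf _ _ fun v hv => ?_⟩
  rw [dotProduct_add, hu v hv, add_zero]

theorem sum_powerset_eq_add_sum_singleton {α M : Type*} [AddCommMonoid M]
    (I : Finset α) (F : Finset α → M) :
    ∑ t ∈ I.powerset, F t = F ∅ + ∑ i ∈ I, F {i} + ∑ t ∈ I.powerset with 1 < t.card, F t := by
  classical
  rw [← Finset.sum_filter_add_sum_filter_not _ (fun t => 1 < t.card), add_comm]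
  congr 1
  have hsmall : I.powerset.filter (fun t => ¬ 1 < t.card) =
      insert ∅ (I.map ⟨fun i => {i}, Finset.singleton_injective⟩) := by
    ext t
    simp only [Finset.mem_filter, Finset.mem_powerset, not_lt, Nat.le_one_iff_eq_zero_or_eq_one,
      Finset.card_eq_zero, Finset.card_eq_one, Finset.mem_insert, Finset.mem_map,
      Function.Embedding.coeFn_mk]
    constructor
    · rintro ⟨hI, rfl | ⟨i, rfl⟩⟩
      · exact .inl rfl
      · exact .inr ⟨i, Finset.singleton_subset_iff.1 hI, rfl⟩
    · rintro (rfl | ⟨i, hi, rfl⟩)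
      · exact ⟨Finset.empty_subset I, .inl rfl⟩
      · exact ⟨Finset.singleton_subset_iff.2 hi, .inr ⟨i, rfl⟩⟩
  rw [hsmall, Finset.sum_insert (by simp), Finset.sum_map]
  rfl

theorem sum_powerset_neg_one_pow_mul_prod_compl [DecidableEq ι] (I : Finset ι) (h : ι → R) :
    ∑ t ∈ I.powerset, (-1) ^ t.card * ∏ j ∈ tᶜ, h j =
      (∏ i ∈ I, (-1 + h i)) * ∏ j ∈ Iᶜ, h j := by
  rw [Finset.prod_add, Finset.sum_mul]
  refine Finset.sum_congr rfl fun t ht => ?_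
  have hcompl : tᶜ = (I \ t) ∪ Iᶜ := by
    have := Finset.mem_powerset.1 ht
    grind [Finset.mem_compl]
  have hdisj : Disjoint (I \ t) Iᶜ :=
    Finset.disjoint_of_subset_left Finset.sdiff_subset disjoint_compl_right
  rw [hcompl, Finset.prod_union hdisj, Finset.prod_const, mul_assoc]

variable {V : Matrix ι ι ℤ} {w b : ι → ℤ} {D : ℤ}

theorem mul_dotProduct_eq_sum_of_smul_eq_vecMul (hw : D • w = b ᵥ* V) (m : ι → ℤ) :
    D * (w ⬝ᵥ m) = ∑ k, b k * (V k ⬝ᵥ m) := by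
  rw [← smul_eq_mul, ← smul_dotProduct, hw, ← dotProduct_mulVec]
  rfl

theorem halfSpaceInd_mul_dualConeInd (hD : 0 < D) (hw : D • w = b ᵥ* V) (hb : 0 ≤ b)
    (m : ι → ℤ) : halfSpaceInd R w m * dualConeInd R V m = dualConeInd R V m := by
  by_cases h : ∀ i, 0 ≤ V i ⬝ᵥ m
  · have hwm : 0 ≤ w ⬝ᵥ m := nonneg_of_mul_nonneg_right
      (mul_dotProduct_eq_sum_of_smul_eq_vecMul hw m ▸
        Finset.sum_nonneg fun k _ => mul_nonneg (hb k) (h k)) hD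
    rw [halfSpaceInd, if_pos hwm, one_mul]
  · rw [dualConeInd, if_neg h, mul_zero]

theorem halfSpaceInd_mul_prod_eq_zero (hD : 0 < D) (hw : D • w = b ᵥ* V) (hb : 0 ≤ b)
    (hb0 : b ≠ 0) (m : ι → ℤ) :
    halfSpaceInd R w m * ∏ i with 0 < b i, (-1 + halfSpaceInd R (V i) m) = 0 := by
  by_cases h : ∃ k, 0 < b k ∧ 0 ≤ V k ⬝ᵥ m
  · obtain ⟨k, hk, hkm⟩ := h
    rw [Finset.prod_eq_zero (Finset.mem_filter.2 ⟨Finset.mem_univ k, hk⟩)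
      (by rw [halfSpaceInd, if_pos hkm, neg_add_cancel]), mul_zero]
  · push Not at h
    obtain ⟨k, hk⟩ := (Pi.lt_def.1 (hb.lt_of_ne' hb0)).2
    have hlt : D * (w ⬝ᵥ m) < 0 := by
      rw [mul_dotProduct_eq_sum_of_smul_eq_vecMul hw]
      refine Finset.sum_neg' (fun i _ => ?_)
        ⟨k, Finset.mem_univ k, mul_neg_of_pos_of_neg hk (h k hk)⟩
      rcases (hb i).eq_or_lt' with hi | hi
      · simp [hi]
      · exact (mul_neg_of_pos_of_neg hi (h i hi)).le
    rw [halfSpaceInd, if_neg (fun hwm => hlt.not_ge (mul_nonneg hD.le hwm)), zero_mul]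

variable [DecidableEq ι]

theorem det_updateRow_of_smul_eq_vecMul (hw : D • w = b ᵥ* V) (i : ι) :
    D * (V.updateRow i w).det = b i * V.det := by
  rw [← det_updateRow_smul, hw, vecMul_eq_sum, det_updateRow_sum, smul_eq_mul]

theorem dualConeInd_updateRow (i : ι) (m : ι → ℤ) :
    dualConeInd R (V.updateRow i w) m =
      halfSpaceInd R w m * ∏ j ∈ {i}ᶜ, halfSpaceInd R (V j) m := by
  rw [dualConeInd_eq_prod, Fintype.prod_eq_mul_prod_compl i, updateRow_self]
  congr 1
  refine Finset.prod_congr rfl fun j hj => ?_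
  rw [updateRow_ne (by simpa using hj)]

theorem mul_prod_compl_mem_periodicSpan (c : R) (V : Matrix ι ι ℤ) (w : ι → ℤ) {t : Finset ι}
    (ht : 1 < t.card) :
    (fun m => c * (halfSpaceInd R w m * ∏ j ∈ tᶜ, halfSpaceInd R (V j) m)) ∈
      periodicSpan R (ι → ℤ) := by
  classical
  refine mem_periodicSpan_of_card_lt (s := insert w (tᶜ.image V)) ?_ fun m m' h => ?_
  · have := Finset.card_insert_le w (tᶜ.image V)
    have := Finset.card_image_le (s := tᶜ) (f := V)
    have := Finset.card_add_card_compl t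
    omega
  · simp only [halfSpaceInd, h w (Finset.mem_insert_self _ _)]
    congr 2
    refine Finset.prod_congr rfl fun j hj => ?_
    rw [h _ (Finset.mem_insert_of_mem (Finset.mem_image_of_mem V hj))]

/-- Star subdivision of a simplicial cone at a vector `w` in it, for the dual cones. -/
theorem dualConeInd_sub_sum_updateRow_mem_periodicSpan (hD : 0 < D) (hw : D • w = b ᵥ* V)
    (hb : 0 ≤ b) (hb0 : b ≠ 0) :
    dualConeInd R V - ∑ i with 0 < b i, dualConeInd R (V.updateRow i w) ∈
      periodicSpan R (ι → ℤ) := by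
  set I : Finset ι := {i | 0 < b i}
  let F : Finset ι → (ι → ℤ) → R := fun t m =>
    (-1) ^ t.card * (halfSpaceInd R w m * ∏ j ∈ tᶜ, halfSpaceInd R (V j) m)
  have hF : ∑ t ∈ I.powerset, F t = 0 := by
    ext m
    simp only [F, Finset.sum_apply, Pi.zero_apply, mul_left_comm _ (halfSpaceInd R w m),
      ← Finset.mul_sum, sum_powerset_neg_one_pow_mul_prod_compl]
    rw [← mul_assoc, halfSpaceInd_mul_prod_eq_zero hD hw hb hb0, zero_mul]
  have hF_empty : F ∅ = dualConeInd R V := by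
    ext m
    simp only [F, Finset.card_empty, pow_zero, one_mul, Finset.compl_empty, ← dualConeInd_eq_prod]
    exact halfSpaceInd_mul_dualConeInd hD hw hb m
  have hF_singleton (i : ι) : F {i} = -dualConeInd R (V.updateRow i w) := by
    ext m
    simp only [F, Finset.card_singleton, pow_one, neg_one_mul, Pi.neg_apply,
      dualConeInd_updateRow]
  have hF_big : ∑ t ∈ I.powerset with 1 < t.card, F t ∈ periodicSpan R (ι → ℤ) :=
    sum_mem fun t ht => mul_prod_compl_mem_periodicSpan _ V w (Finset.mem_filter.1 ht).2
  rw [sum_powerset_eq_add_sum_singleton, hF_empty] at hF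
  simp only [hF_singleton, Finset.sum_neg_distrib, ← sub_eq_add_neg] at hF
  rw [eq_neg_of_add_eq_zero_left hF]
  exact neg_mem hF_big

theorem isUnit_det_of_dvd_adjugate {A : Type*} [CommRing A] [IsDomain A] {V : Matrix ι ι A}
    (hV : V.det ≠ 0) (h : ∀ i j, V.det ∣ V.adjugate i j) : IsUnit V.det := by
  choose B hB using h
  have hadj : V.adjugate = V.det • Matrix.of B := by
    ext i j
    exact hB i j
  have hinv : Matrix.of B * V = 1 := by
    refine smul_right_injective _ hV ?_
    simp only [← smul_mul_assoc, ← hadj, adjugate_mul]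
  exact isUnit_det_of_left_inverse hinv

theorem exists_smul_eq_vecMul_of_not_isUnit_det (hV : V.det ≠ 0) (hu : ¬ IsUnit V.det) :
    ∃ w b : ι → ℤ, |V.det| • w = b ᵥ* V ∧ 0 ≤ b ∧ b ≠ 0 ∧ ∀ k, b k < |V.det| := by
  obtain ⟨i, j, hij⟩ : ∃ i j, ¬ V.det ∣ V.adjugate i j := by
    by_contra! h
    exact hu (isUnit_det_of_dvd_adjugate hV h)
  have hD : 0 < |V.det| := abs_pos.2 hV
  have hrow : V.adjugate i ᵥ* V = V.det • Pi.single i 1 := by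
    ext l
    have := congrFun (congrFun V.adjugate_mul i) l
    simpa [Matrix.mul_apply, Matrix.one_apply, Pi.single_apply, eq_comm, vecMul, dotProduct]
      using this
  refine ⟨V.det.sign • Pi.single i 1 - (fun k => V.adjugate i k / |V.det|) ᵥ* V,
    fun k => V.adjugate i k % |V.det|, ?_, fun k => Int.emod_nonneg _ hD.ne', fun h => hij ?_,
    fun k => Int.emod_lt_of_pos _ hD⟩
  · rw [smul_sub, smul_smul, mul_comm, Int.sign_mul_abs, ← hrow, ← smul_vecMul, ← sub_vecMul]
    congr 1
    ext k
    exact (Int.emod_def _ _).symm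
  · exact (abs_dvd _ _).1 (Int.dvd_of_emod_eq_zero (congrFun h j))

theorem dualConeInd_mem_closure_unimodular_sup_periodicSpan (V : Matrix ι ι ℤ) (hV : V.det ≠ 0) :
    dualConeInd R V ∈
      AddSubgroup.closure {f | ∃ W : Matrix ι ι ℤ, IsUnit W.det ∧ dualConeInd R W = f} ⊔
        periodicSpan R (ι → ℤ) := by
  induction hd : V.det.natAbs using Nat.strong_induction_on generalizing V with
  | _ d ih =>
  by_cases hu : IsUnit V.det
  · exact AddSubgroup.mem_sup_left (AddSubgroup.subset_closure ⟨V, hu, rfl⟩)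
  obtain ⟨w, b, hw, hb, hb0, hlt⟩ := exists_smul_eq_vecMul_of_not_isUnit_det hV hu
  have hstar := dualConeInd_sub_sum_updateRow_mem_periodicSpan (R := R) (abs_pos.2 hV) hw hb hb0
  rw [← sub_add_cancel (dualConeInd R V) (∑ i with 0 < b i, dualConeInd R (V.updateRow i w))]
  refine add_mem (AddSubgroup.mem_sup_right hstar) (sum_mem fun i hi => ?_)
  have hbi : 0 < b i := (Finset.mem_filter.1 hi).2
  have hdet : |(V.updateRow i w).det| = b i := by
    have := congrArg abs (det_updateRow_of_smul_eq_vecMul hw i)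
    rw [abs_mul, abs_mul, abs_abs, abs_of_pos hbi, mul_comm] at this
    exact mul_right_cancel₀ (abs_ne_zero.2 hV) this
  refine ih _ ?_ _ (abs_pos.1 (hdet ▸ hbi)) rfl
  rw [← hd]
  zify
  exact hdet ▸ hlt i

end Decomposition

section GeneratingFunction

variable {R G L : Type*} [CommRing R] [AddCommGroup G] [Field L] [Algebra R L]

variable (R G) in
/-- Translation of functions on an abelian group. -/
def translate : Multiplicative G →* Module.End R (G → R) where
  toFun u := LinearMap.funLeft R R fun m => m - u.toAdd
  map_one' := by
    ext f m
    simp [LinearMap.funLeft_apply]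
  map_mul' u v := by
    ext f m
    simp [LinearMap.funLeft_apply, sub_sub]

variable (R G) in
/-- The convolution action of the group ring `R[G]` on functions on `G`. -/
def convolve : AddMonoidAlgebra R G →ₐ[R] Module.End R (G → R) :=
  AddMonoidAlgebra.lift R _ G (translate R G)

/-- The evaluation of the group ring `R[G]` at the character `z`. -/
def evalChar (z : Multiplicative G →* L) : AddMonoidAlgebra R G →ₐ[R] L :=
  AddMonoidAlgebra.lift R _ G z

/-- `f` has the generating function `s`, that is `∑ m, f m * z m = s` in the sense of rational
functions: convolution with an element of the group ring on which `z` does not vanish makes `f`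
finitely supported, and `s` is the quotient of the values at `z`. -/
def HasGenSum (z : Multiplicative G →* L) (f : G → R) (s : L) : Prop :=
  ∃ P Q : AddMonoidAlgebra R G, evalChar z P ≠ 0 ∧ convolve R G P f = ⇑Q.coeff ∧
    evalChar z Q = s * evalChar z P

theorem convolve_single (u : G) (a : R) (f : G → R) (m : G) :
    convolve R G (AddMonoidAlgebra.single u a) f m = a * f (m - u) := by
  simp [convolve, AddMonoidAlgebra.lift_single, translate, LinearMap.funLeft_apply]

theorem convolve_coeff (P Q : AddMonoidAlgebra R G) :
    convolve R G P ⇑Q.coeff = ⇑(P * Q).coeff := by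
  induction P using AddMonoidAlgebra.induction_linear with
  | zero => simp
  | add f g hf hg =>
    rw [map_add, LinearMap.add_apply, hf, hg, add_mul]
    rfl
  | single u a =>
    ext m
    rw [convolve_single, AddMonoidAlgebra.coeff_single_mul_apply, sub_eq_neg_add]

variable {z : Multiplicative G →* L}

theorem evalChar_single (u : G) (a : R) :
    evalChar z (AddMonoidAlgebra.single u a) = algebraMap R L a * z (.ofAdd u) := by
  rw [evalChar, AddMonoidAlgebra.lift_single, Algebra.smul_def]

theorem HasGenSum.zero : HasGenSum z (0 : G → R) 0 :=
  ⟨1, 0, by simp, by rw [map_zero]; rfl, by simp⟩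

theorem HasGenSum.add {f g : G → R} {s t : L} (hf : HasGenSum z f s) (hg : HasGenSum z g t) :
    HasGenSum z (f + g) (s + t) := by
  obtain ⟨P, Q, hP, hPQ, hQ⟩ := hf
  obtain ⟨P', Q', hP', hPQ', hQ'⟩ := hg
  refine ⟨P * P', P' * Q + P * Q', ?_, ?_, ?_⟩
  · rw [map_mul]
    exact mul_ne_zero hP hP'
  · rw [map_add]
    nth_rewrite 1 [mul_comm P P']
    rw [map_mul, map_mul, Module.End.mul_apply, Module.End.mul_apply, hPQ, hPQ', convolve_coeff,
      convolve_coeff]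
    rfl
  · rw [map_add, map_mul, map_mul, map_mul, hQ, hQ']
    ring

theorem HasGenSum.smul {f : G → R} {s : L} (c : R) (hf : HasGenSum z f s) :
    HasGenSum z (c • f) (c • s) := by
  obtain ⟨P, Q, hP, hPQ, hQ⟩ := hf
  refine ⟨P, c • Q, hP, ?_, ?_⟩
  · rw [map_smul, hPQ]
    rfl
  · rw [map_smul, hQ, smul_mul_assoc]

theorem HasGenSum.neg {f : G → R} {s : L} (hf : HasGenSum z f s) : HasGenSum z (-f) (-s) := by
  simpa using hf.smul (-1)

theorem HasGenSum.sum {α : Type*} {t : Finset α} {f : α → G → R} {s : α → L}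
    (h : ∀ i ∈ t, HasGenSum z (f i) (s i)) : HasGenSum z (∑ i ∈ t, f i) (∑ i ∈ t, s i) := by
  induction t using Finset.cons_induction with
  | empty => simpa using HasGenSum.zero
  | cons i t hi ih =>
    rw [Finset.sum_cons, Finset.sum_cons]
    exact (h i (Finset.mem_cons_self i t)).add (ih fun j hj => h j (Finset.mem_cons_of_mem hj))

theorem HasGenSum.eq_zero {s : L} (h : HasGenSum z (0 : G → R) s) : s = 0 := by
  obtain ⟨P, Q, hP, hPQ, hQ⟩ := h
  have hQ0 : Q = 0 := by
    ext m
    rw [map_zero] at hPQ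
    exact (congrFun hPQ m).symm
  rw [hQ0, map_zero] at hQ
  exact (mul_eq_zero.1 hQ.symm).resolve_right hP

theorem HasGenSum.unique {f : G → R} {s t : L} (hs : HasGenSum z f s) (ht : HasGenSum z f t) :
    s = t := by
  have h := hs.add ht.neg
  rw [add_neg_cancel] at h
  exact eq_of_sub_eq_zero (sub_eq_add_neg s t ▸ h.eq_zero)

theorem HasGenSum.of_sub_translate {f : G → R} {s : L} {u : G} {a : R}
    (ha : algebraMap R L a * z (.ofAdd u) ≠ 1)
    (h : HasGenSum z (fun m => f m - a * f (m - u)) s) :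
    HasGenSum z f (s * (1 - algebraMap R L a * z (.ofAdd u))⁻¹) := by
  obtain ⟨P, Q, hP, hPQ, hQ⟩ := h
  have hne : 1 - algebraMap R L a * z (.ofAdd u) ≠ 0 := sub_ne_zero.2 ha.symm
  have heval : evalChar z (1 - AddMonoidAlgebra.single u a) =
      1 - algebraMap R L a * z (.ofAdd u) := by
    rw [map_sub, map_one, evalChar_single]
  have hconv : convolve R G (1 - AddMonoidAlgebra.single u a) f =
      fun m => f m - a * f (m - u) := by
    ext m
    rw [map_sub, map_one, LinearMap.sub_apply, Pi.sub_apply, convolve_single,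
      Module.End.one_apply]
  refine ⟨P * (1 - AddMonoidAlgebra.single u a), Q, ?_, ?_, ?_⟩
  · rw [map_mul, heval]
    exact mul_ne_zero hP hne
  · rw [map_mul, Module.End.mul_apply, hconv, hPQ]
  · rw [map_mul, heval, hQ, mul_mul_mul_comm, mul_comm _ (evalChar z P), mul_assoc,
      inv_mul_cancel₀ hne]
    ring

theorem hasGenSum_zero_of_mem_periodicSpan (hz : ∀ u : G, u ≠ 0 → z (.ofAdd u) ≠ 1)
    {f : G → R} (hf : f ∈ periodicSpan R G) : HasGenSum z f 0 := by
  induction hf using AddSubgroup.closure_induction with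
  | mem f hf =>
    obtain ⟨u, hu, hfu⟩ := hf
    have h : HasGenSum z (fun m => f m - 1 * f (m - u)) 0 := by
      simpa [hfu.sub_eq] using! HasGenSum.zero
    simpa using h.of_sub_translate (by simpa using hz u hu)
  | zero => exact .zero
  | add f g _ _ hf hg => simpa using hf.add hg
  | neg f _ hf => simpa using hf.neg

theorem coeff_mapDomain_eq_extend {G H : Type*} {ψ : G → H} (hψ : Function.Injective ψ)
    (P : AddMonoidAlgebra R G) : ⇑(P.mapDomain ψ).coeff = Function.extend ψ P.coeff 0 := by
  ext m
  by_cases hm : m ∈ Set.range ψ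
  · obtain ⟨k, rfl⟩ := hm
    rw [hψ.extend_apply]
    exact Finsupp.mapDomain_apply hψ _ k
  · rw [Function.extend_apply' _ _ _ hm]
    exact Finsupp.mapDomain_of_notMem_range _ m hm

theorem evalChar_mapDomain {H : Type*} [AddCommGroup H] (z : Multiplicative H →* L) (ψ : G →+ H)
    (P : AddMonoidAlgebra R G) : evalChar z (P.mapDomain ψ) =
      evalChar (z.comp ψ.toMultiplicative) P := by
  induction P using AddMonoidAlgebra.induction_linear with
  | zero => simp
  | add P Q hP hQ => rw [AddMonoidAlgebra.mapDomain_add, map_add, hP, hQ, map_add]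
  | single u a =>
    rw [AddMonoidAlgebra.mapDomain_single, evalChar_single, evalChar_single]
    rfl

theorem convolve_mapDomain_extend {H : Type*} [AddCommGroup H] {ψ : G →+ H}
    (hψ : Function.Injective ψ) (P : AddMonoidAlgebra R G) (f : G → R) :
    convolve R H (P.mapDomain ψ) (Function.extend ψ f 0) =
      Function.extend ψ (convolve R G P f) 0 := by
  induction P using AddMonoidAlgebra.induction_linear with
  | zero =>
    simp only [AddMonoidAlgebra.mapDomain_zero, map_zero, LinearMap.zero_apply]
    exact (map_zero (Function.ExtendByZero.linearMap R ψ)).symm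
  | add P Q hP hQ =>
    simp only [AddMonoidAlgebra.mapDomain_add, map_add, LinearMap.add_apply, hP, hQ]
    exact (map_add (Function.ExtendByZero.linearMap R ψ) _ _).symm
  | single u a =>
    ext m
    rw [AddMonoidAlgebra.mapDomain_single, convolve_single]
    by_cases hm : m ∈ Set.range ψ
    · obtain ⟨k, rfl⟩ := hm
      rw [← map_sub, hψ.extend_apply, hψ.extend_apply, convolve_single]
    · have hmu : ¬ m - ψ u ∈ Set.range ψ := fun ⟨k, hk⟩ =>
        hm ⟨k + u, by rw [map_add, hk, sub_add_cancel]⟩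
      rw [Function.extend_apply' _ _ _ hm, Function.extend_apply' _ _ _ hmu, Pi.zero_apply,
        Pi.zero_apply, mul_zero]

theorem HasGenSum.extend {H : Type*} [AddCommGroup H] {z : Multiplicative H →* L} {ψ : G →+ H}
    (hψ : Function.Injective ψ) {f : G → R} {s : L}
    (h : HasGenSum (z.comp ψ.toMultiplicative) f s) :
    HasGenSum z (Function.extend ψ f 0) s := by
  obtain ⟨P, Q, hP, hPQ, hQ⟩ := h
  refine ⟨P.mapDomain ψ, Q.mapDomain ψ, ?_, ?_, ?_⟩
  · rwa [evalChar_mapDomain]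
  · rw [convolve_mapDomain_extend hψ, hPQ, coeff_mapDomain_eq_extend hψ]
  · rw [evalChar_mapDomain, evalChar_mapDomain, hQ]

variable {ι : Type*} [Fintype ι]

/-- The geometric sequence `k ↦ a ^ k`, extended by zero to negative `k`. -/
def geom (a : R) (k : ℤ) : R := if 0 ≤ k then a ^ k.toNat else 0

theorem geom_sub_mul_geom (a : R) (k : ℤ) :
    geom a k - a * geom a (k - 1) = if k = 0 then 1 else 0 := by
  rcases lt_trichotomy k 0 with hk | rfl | hk
  · simp [geom, hk.not_ge, hk.ne, show ¬ 1 ≤ k by omega]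
  · simp [geom]
  · have hpow : k.toNat = (k - 1).toNat + 1 := by omega
    simp only [geom, hk.le, hk.ne', sub_nonneg, show 1 ≤ k by omega, if_true, if_false, hpow,
      pow_succ]
    ring

/-- The function `m ↦ ∏ j, a_j ^ m_j` on the orthant of `ℤ^ι`, extended by zero. -/
def orthantPow (a : ι → R) (m : ι → ℤ) : R := ∏ j, geom (a j) (m j)

theorem orthantPow_one (m : ι → ℤ) :
    orthantPow (1 : ι → R) m = if ∀ j, 0 ≤ m j then 1 else 0 := by
  simp only [orthantPow, geom, Pi.one_apply, one_pow, Finset.prod_ite_zero,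
    Finset.prod_const_one, Finset.mem_univ, true_imp_iff]

theorem hasGenSum_indicator_zero {z : Multiplicative (ι → ℤ) →* L} :
    HasGenSum z (fun m => ∏ j : ι, if m j = 0 then (1 : R) else 0) 1 := by
  refine ⟨1, 1, by simp, ?_, by simp⟩
  ext m
  rw [map_one, Module.End.one_apply, AddMonoidAlgebra.one_def, AddMonoidAlgebra.coeff_single,
    Finsupp.single_apply, Finset.prod_ite_zero]
  simp [funext_iff, eq_comm]

variable [DecidableEq ι] {z : Multiplicative (ι → ℤ) →* L}

theorem hasGenSum_orthantPow {a : ι → R}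
    (ha : ∀ j, algebraMap R L (a j) * z (.ofAdd (Pi.single j 1)) ≠ 1) :
    HasGenSum z (orthantPow a)
      (∏ j, (1 - algebraMap R L (a j) * z (.ofAdd (Pi.single j 1)))⁻¹) := by
  let point (k : ℤ) : R := if k = 0 then 1 else 0
  suffices h : ∀ s : Finset ι, HasGenSum z
      (fun m => (∏ j ∈ s, geom (a j) (m j)) * ∏ j ∈ sᶜ, point (m j))
      (∏ j ∈ s, (1 - algebraMap R L (a j) * z (.ofAdd (Pi.single j 1)))⁻¹) by
    convert h Finset.univ using 2 with m
    simp [orthantPow]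
  intro s
  induction s using Finset.induction_on with
  | empty => simpa using hasGenSum_indicator_zero
  | insert i s hi ih =>
    rw [Finset.prod_insert hi, mul_comm]
    refine HasGenSum.of_sub_translate (ha i) ?_
    convert ih using 2 with m
    have hs : ∏ j ∈ s, geom (a j) ((m - Pi.single i 1 : ι → ℤ) j) = ∏ j ∈ s, geom (a j) (m j) :=
      Finset.prod_congr rfl fun j hj => by simp [show j ≠ i from fun h => hi (h ▸ hj)]
    have hsc : ∏ j ∈ (insert i s)ᶜ, point ((m - Pi.single i 1 : ι → ℤ) j) =
        ∏ j ∈ (insert i s)ᶜ, point (m j) :=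
      Finset.prod_congr rfl fun j hj => by
        simp [show j ≠ i from fun h => by simp [h] at hj]
    have hpoint : geom (a i) (m i) - a i * geom (a i) (m i - 1) = point (m i) :=
      geom_sub_mul_geom _ _
    rw [Finset.prod_insert hi, Finset.prod_insert hi, hs, hsc, Pi.sub_apply, Pi.single_eq_same,
      ← Finset.mul_prod_erase sᶜ _ (Finset.mem_compl.2 hi), ← hpoint, Finset.compl_insert]
    ring

theorem dualConeInd_eq_extend {W U : Matrix ι ι ℤ} (h : W * U = 1) :
    dualConeInd R W = Function.extend U.mulVecLin (orthantPow 1) 0 := by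
  ext m
  have hU : Function.Injective U.mulVecLin :=
    mulVec_injective_of_det_ne_zero (isUnit_det_of_left_inverse h).ne_zero
  have hm : m = U.mulVecLin (W *ᵥ m) := by simp [mulVec_mulVec, mul_eq_one_comm.1 h]
  conv_rhs => rw [hm, hU.extend_apply]
  rw [orthantPow_one]
  rfl

theorem hasGenSum_dualConeInd_of_mul_eq_one (hz : ∀ u : ι → ℤ, u ≠ 0 → z (.ofAdd u) ≠ 1)
    {W U : Matrix ι ι ℤ} (h : W * U = 1) :
    HasGenSum z (dualConeInd R W) (∏ j, (1 - z (.ofAdd (U.col j)))⁻¹) := by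
  have hU : Function.Injective U.mulVecLin :=
    mulVec_injective_of_det_ne_zero (isUnit_det_of_left_inverse h).ne_zero
  have hcol (j : ι) : U.mulVecLin (Pi.single j 1) = U.col j := mulVec_single_one U j
  have hcol_ne (j : ι) : U.col j ≠ 0 := hcol j ▸ (map_ne_zero_iff _ hU).2 (by simp)
  rw [dualConeInd_eq_extend h]
  refine HasGenSum.extend (ψ := U.mulVecLin.toAddMonoidHom) hU ?_
  have hsum := hasGenSum_orthantPow (a := (1 : ι → R))
    (z := z.comp U.mulVecLin.toAddMonoidHom.toMultiplicative)
    fun j => by simpa [hcol] using hz _ (hcol_ne j)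
  simpa [hcol] using hsum

theorem exists_hasGenSum_dualConeInd (hz : ∀ u : ι → ℤ, u ≠ 0 → z (.ofAdd u) ≠ 1)
    {V : Matrix ι ι ℤ} (hV : V.det ≠ 0) :
    ∃ s ∈ AddSubgroup.closure
        {s | ∃ U : Matrix ι ι ℤ, IsUnit U.det ∧ ∏ j, (1 - z (.ofAdd (U.col j)))⁻¹ = s},
      HasGenSum z (dualConeInd R V) s := by
  obtain ⟨f, hf, g, hg, hfg⟩ :=
    AddSubgroup.mem_sup.1 (dualConeInd_mem_closure_unimodular_sup_periodicSpan (R := R) V hV)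
  suffices h : ∃ s ∈ AddSubgroup.closure
      {s | ∃ U : Matrix ι ι ℤ, IsUnit U.det ∧ ∏ j, (1 - z (.ofAdd (U.col j)))⁻¹ = s},
      HasGenSum z f s by
    obtain ⟨s, hs, hfs⟩ := h
    exact ⟨s, hs, by simpa [hfg] using hfs.add (hasGenSum_zero_of_mem_periodicSpan hz hg)⟩
  clear hfg
  induction hf using AddSubgroup.closure_induction with
  | mem f hf =>
    obtain ⟨W, hW, rfl⟩ := hf
    exact ⟨_, AddSubgroup.subset_closure ⟨W⁻¹, isUnit_nonsing_inv_det W hW, rfl⟩,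
      hasGenSum_dualConeInd_of_mul_eq_one hz (mul_nonsing_inv W hW)⟩
  | zero => exact ⟨0, zero_mem _, .zero⟩
  | add f g _ _ hf hg =>
    obtain ⟨s, hs, hfs⟩ := hf
    obtain ⟨t, ht, hgt⟩ := hg
    exact ⟨s + t, add_mem hs ht, hfs.add hgt⟩
  | neg f _ hf =>
    obtain ⟨s, hs, hfs⟩ := hf
    exact ⟨-s, neg_mem hs, hfs.neg⟩

end GeneratingFunction

section CharacterSum

namespace SimplicialCone

variable {n : ℕ} (C : SimplicialCone n)

theorem card_Gamma : Fintype.card C.Gamma = C.M.det.natAbs := by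
  rw [← Nat.card_eq_fintype_card, ← Submodule.natAbs_det_basis_change (Pi.basisFun ℤ (Fin n))
    C.lattice (Module.Basis.span C.linearIndependent_gen), Module.Basis.det_apply]
  congr 2
  ext i j
  simp only [Module.Basis.toMatrix_apply, Function.comp_apply, Pi.basisFun_repr, M, of_apply]
  exact congrFun (congrArg Subtype.val (Module.Basis.span_apply C.linearIndependent_gen j)) i

theorem char_mk (j : Fin n) (v : Fin n → ℤ) :
    C.char j (Submodule.Quotient.mk v) = Complex.exp (C.coord j v * (2 * Real.pi * Complex.I)) := by
  rw [mul_comm]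
  rfl

/-- The character `χ_j` as a bundled additive character, for the orthogonality relations. -/
def addChar (j : Fin n) : AddChar C.Gamma ℂ where
  toFun := C.char j
  map_zero_eq_one' := by
    rw [← Submodule.Quotient.mk_zero, char_mk]
    simp
  map_add_eq_mul' a b := by
    induction a using Submodule.Quotient.induction_on
    induction b using Submodule.Quotient.induction_on
    rw [← Submodule.Quotient.mk_add, char_mk, char_mk, char_mk, ← Complex.exp_add, map_add, add_mul]

theorem char_pow_card (j : Fin n) (γ : C.Gamma) : C.char j γ ^ Fintype.card C.Gamma = 1 := by
  have h := (C.addChar j).map_nsmul_eq_pow (Fintype.card C.Gamma) γ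
  rw [card_nsmul_eq_zero, AddChar.map_zero_eq_one] at h
  exact h.symm

theorem prod_addChar_pow_mk (k : Fin n → ℕ) (v : Fin n → ℤ) :
    (∏ j, C.addChar j ^ k j) (Submodule.Quotient.mk v) =
      Complex.exp (((fun j => (k j : ℂ)) ᵥ* C.MC⁻¹) ⬝ᵥ (fun l => (v l : ℂ)) *
        (2 * Real.pi * Complex.I)) := by
  have hsum : ((fun j => (k j : ℂ)) ᵥ* C.MC⁻¹) ⬝ᵥ (fun l => (v l : ℂ)) =
      ∑ j, k j * C.coord j v := (dotProduct_mulVec _ _ _).symm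
  rw [hsum, Finset.sum_mul, Complex.exp_sum, AddChar.prod_apply]
  refine Finset.prod_congr rfl fun j _ => ?_
  rw [AddChar.pow_apply, mul_assoc, Complex.exp_nat_mul, ← char_mk]
  rfl

end SimplicialCone

theorem forall_exists_dotProduct_eq_intCast_iff {R ι : Type*} [Ring R] [Fintype ι]
    (w : ι → R) :
    (∀ v : ι → ℤ, ∃ a : ℤ, w ⬝ᵥ (fun l => (v l : R)) = a) ↔
      ∃ m : ι → ℤ, w = fun l => (m l : R) := by
  classical
  constructor
  · intro h
    choose a ha using h
    refine ⟨fun l => a (Pi.single l 1), funext fun l => ?_⟩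
    rw [← ha, ← dotProduct_single_one w l]
    congr 1
    ext i
    simp [Pi.single_apply]
  · rintro ⟨m, rfl⟩ v
    exact ⟨m ⬝ᵥ v, by simp [dotProduct]⟩

namespace SimplicialCone

variable {n : ℕ} (C : SimplicialCone n)

theorem vecMul_inv_MC_eq_intCast_iff (k : Fin n → ℕ) (m : Fin n → ℤ) :
    (fun j => (k j : ℂ)) ᵥ* C.MC⁻¹ = (fun l => (m l : ℂ)) ↔ C.Mᵀ *ᵥ m = fun j => (k j : ℤ) := by
  have hunit : IsUnit C.MC.det := isUnit_iff_ne_zero.2 C.det_MC_ne_zero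
  have hcast : (fun l => (m l : ℂ)) ᵥ* C.MC = fun j => (((C.Mᵀ *ᵥ m) j : ℤ) : ℂ) := by
    ext j
    simp [mulVec_transpose, vecMul, dotProduct, MC]
  have hsolve : (fun j => (k j : ℂ)) ᵥ* C.MC⁻¹ = (fun l => (m l : ℂ)) ↔
      (fun l => (m l : ℂ)) ᵥ* C.MC = fun j => (k j : ℂ) := by
    constructor
    · rintro h
      rw [← h, vecMul_vecMul, nonsing_inv_mul _ hunit, vecMul_one]
    · rintro h
      rw [← h, vecMul_vecMul, mul_nonsing_inv _ hunit, vecMul_one]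
  rw [hsolve, hcast, funext_iff, funext_iff]
  exact forall_congr' fun j => by norm_cast

theorem prod_addChar_pow_eq_zero_iff (k : Fin n → ℕ) :
    ∏ j, C.addChar j ^ k j = 0 ↔ ∃ m : Fin n → ℤ, C.Mᵀ *ᵥ m = fun j => (k j : ℤ) := by
  simp only [← vecMul_inv_MC_eq_intCast_iff, ← forall_exists_dotProduct_eq_intCast_iff]
  rw [DFunLike.ext_iff]
  refine (Submodule.Quotient.mk_surjective C.lattice).forall.trans (forall_congr' fun v => ?_)
  rw [AddChar.zero_apply, prod_addChar_pow_mk, Complex.exp_eq_one_iff]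
  exact exists_congr fun a => mul_left_inj' Complex.two_pi_I_ne_zero

open Classical in
theorem sum_prod_char_pow (k : Fin n → ℕ) :
    ∑ γ : C.Gamma, ∏ j, C.char j γ ^ k j =
      if ∃ m : Fin n → ℤ, C.Mᵀ *ᵥ m = fun j => (k j : ℤ) then (Fintype.card C.Gamma : ℂ)
      else 0 := by
  rw [← if_congr (C.prod_addChar_pow_eq_zero_iff k) rfl rfl, ← AddChar.sum_eq_ite]
  simp only [AddChar.prod_apply, AddChar.pow_apply]
  rfl

theorem mulVec_transpose_M_injective : Function.Injective C.Mᵀ.mulVec :=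
  mulVec_injective_of_det_ne_zero (det_transpose C.M ▸ C.det_ne_zero)

theorem card_smul_extend_dualConeInd :
    (Fintype.card C.Gamma : ℂ) • Function.extend C.Mᵀ.mulVec (dualConeInd ℂ C.Mᵀ) 0 =
      ∑ γ : C.Gamma, orthantPow fun j => C.char j γ := by
  ext k
  rw [Pi.smul_apply, smul_eq_mul, Finset.sum_apply]
  by_cases hk : ∀ j, 0 ≤ k j
  · have hpow (γ : C.Gamma) : orthantPow (fun j => C.char j γ) k =
        ∏ j, C.char j γ ^ (k j).toNat := by
      simp [orthantPow, geom, hk]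
    have hcast : (fun j => ((k j).toNat : ℤ)) = k := funext fun j => Int.toNat_of_nonneg (hk j)
    rw [Finset.sum_congr rfl fun γ _ => hpow γ, sum_prod_char_pow, hcast]
    split_ifs with hm
    · obtain ⟨m, rfl⟩ := hm
      have hind : dualConeInd ℂ C.Mᵀ m = 1 := if_pos hk
      rw [C.mulVec_transpose_M_injective.extend_apply, hind, mul_one]
    · rw [Function.extend_apply' _ _ _ hm, Pi.zero_apply, mul_zero]
  · have hpow (γ : C.Gamma) : orthantPow (fun j => C.char j γ) k = 0 := by
      obtain ⟨j, hj⟩ := not_forall.1 hk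
      exact Finset.prod_eq_zero (Finset.mem_univ j) (if_neg hj)
    rw [Finset.sum_eq_zero fun γ _ => hpow γ]
    by_cases hm : ∃ m, C.Mᵀ *ᵥ m = k
    · obtain ⟨m, rfl⟩ := hm
      have hind : dualConeInd ℂ C.Mᵀ m = 0 := if_neg hk
      rw [C.mulVec_transpose_M_injective.extend_apply, hind, mul_zero]
    · rw [Function.extend_apply' _ _ _ hm, Pi.zero_apply, mul_zero]

variable {L : Type*} [Field L] [Algebra ℂ L] {z : Multiplicative (Fin n → ℤ) →* L}

theorem char_mul_ne_one (hz : ∀ u : Fin n → ℤ, u ≠ 0 → z (.ofAdd u) ≠ 1) (j : Fin n)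
    (γ : C.Gamma) : algebraMap ℂ L (C.char j γ) * z (.ofAdd (Pi.single j 1)) ≠ 1 := by
  intro h
  have hpow := congrArg (· ^ Fintype.card C.Gamma) h
  simp only [mul_pow, ← map_pow, char_pow_card, map_one, one_mul, one_pow, ← ofAdd_nsmul] at hpow
  refine hz _ (fun h0 => ?_) hpow
  simpa using congrFun h0 j

theorem hasGenSum_sum_orthantPow_char (hz : ∀ u : Fin n → ℤ, u ≠ 0 → z (.ofAdd u) ≠ 1) :
    HasGenSum z (∑ γ : C.Gamma, orthantPow fun j => C.char j γ) (∑ γ : C.Gamma,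
      ∏ j, (1 - algebraMap ℂ L (C.char j γ) * z (.ofAdd (Pi.single j 1)))⁻¹) :=
  .sum fun γ _ => hasGenSum_orthantPow fun j => C.char_mul_ne_one hz j γ

theorem exists_sum_prod_inv_one_sub_char_eq_nsmul
    (hz : ∀ u : Fin n → ℤ, u ≠ 0 → z (.ofAdd u) ≠ 1) :
    ∃ s ∈ AddSubgroup.closure {s | ∃ A : Matrix (Fin n) (Fin n) ℤ,
        A.det.natAbs = C.M.det.natAbs ∧ ∏ j, (1 - z (.ofAdd (A.col j)))⁻¹ = s},
      ∑ γ : C.Gamma, ∏ j, (1 - algebraMap ℂ L (C.char j γ) * z (.ofAdd (Pi.single j 1)))⁻¹ =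
        Fintype.card C.Gamma • s := by
  have hdet : C.Mᵀ.det ≠ 0 := det_transpose C.M ▸ C.det_ne_zero
  obtain ⟨s, hs, hsum⟩ := exists_hasGenSum_dualConeInd (R := ℂ)
    (z := z.comp C.Mᵀ.mulVecLin.toAddMonoidHom.toMultiplicative)
    (fun u hu => hz _ ((map_ne_zero_iff C.Mᵀ.mulVecLin C.mulVec_transpose_M_injective).2 hu)) hdet
  refine ⟨s, AddSubgroup.closure_mono ?_ hs, (C.hasGenSum_sum_orthantPow_char hz).unique ?_⟩
  · rintro _ ⟨U, hU, rfl⟩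
    refine ⟨C.Mᵀ * U, ?_, rfl⟩
    rw [det_mul, det_transpose, Int.natAbs_mul, Int.isUnit_iff_natAbs_eq.1 hU, mul_one]
  · rw [← Nat.cast_smul_eq_nsmul ℂ, ← card_smul_extend_dualConeInd]
    exact (hsum.extend (ψ := C.Mᵀ.mulVecLin.toAddMonoidHom) C.mulVec_transpose_M_injective).smul _

end SimplicialCone

end CharacterSum

section LaurentExpansion

theorem coeff_prod_subst_X {F ι : Type*} [CommRing F] [Fintype ι] (f : ι → PowerSeries F)
    (r : ι →₀ ℕ) :
    MvPowerSeries.coeff r (∏ i, PowerSeries.subst (MvPowerSeries.X i : MvPowerSeries ι F) (f i)) =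
      ∏ i, PowerSeries.coeff (r i) (f i) := by
  classical
  rw [MvPowerSeries.coeff_prod]
  simp only [PowerSeries.coeff_subst_single]
  rw [Finset.sum_eq_single (Finsupp.equivFunOnFinite.symm fun i => Finsupp.single i (r i))]
  · exact Finset.prod_congr rfl fun i _ => by simp
  · intro l hl hne
    by_contra h0
    have hsingle (i : ι) : l i = Finsupp.single i (l i i) := by
      by_contra h
      exact h0 (Finset.prod_eq_zero (Finset.mem_univ i) (if_neg h))
    refine hne (Finsupp.ext fun i => ?_)
    rw [Finsupp.equivFunOnFinite_symm_apply_apply, ← (Finset.mem_finsuppAntidiag.1 hl).1, hsingle i,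
      Finsupp.finsetSum_apply, Finset.sum_eq_single_of_mem i (Finset.mem_univ i)]
    intro j _ hj
    rw [hsingle j, Finsupp.single_eq_of_ne hj.symm]
  · intro h
    refine absurd (Finset.mem_finsuppAntidiag.2 ⟨?_, by simp⟩) h
    ext i
    simp

theorem homogPart_sum {F α : Type*} [CommSemiring F] {n : ℕ} (s : Finset α)
    (f : α → MvPowerSeries (Fin n) F) (N : ℕ) :
    homogPart (∑ i ∈ s, f i) N = ∑ i ∈ s, homogPart (f i) N := by
  simp only [homogPart, map_sum]
  rw [Finset.sum_comm]

theorem aeval_homogPart_prod_subst {F K : Type*} [CommRing F] [CommRing K] [Algebra F K] {n : ℕ}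
    (f : Fin n → PowerSeries F) (x : Fin n → K) (N : ℕ) :
    MvPolynomial.aeval x (homogPart (∏ i, PowerSeries.subst
      (MvPowerSeries.X i : MvPowerSeries (Fin n) F) (f i)) N) =
      PowerSeries.coeff N (∏ i, PowerSeries.rescale (x i)
        (PowerSeries.map (algebraMap F K) (f i))) := by
  rw [PowerSeries.coeff_prod, homogPart, map_sum]
  refine Finset.sum_congr rfl fun r _ => ?_
  rw [MvPolynomial.aeval_monomial, coeff_prod_subst_X, map_prod, Finsupp.prod_fintype _ _ (by simp),
    ← Finset.prod_mul_distrib]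
  refine Finset.prod_congr rfl fun i _ => ?_
  rw [PowerSeries.coeff_rescale, PowerSeries.coeff_map, mul_comm]

section ExpNeg

variable {K : Type*} [CommRing K] [Algebra ℚ K]

/-- The power series `exp (-a t)` in `t`. -/
def expNeg (a : K) : PowerSeries K := PowerSeries.rescale (-a) (PowerSeries.exp K)

theorem expNeg_zero : expNeg (0 : K) = 1 := by
  simp [expNeg]

theorem expNeg_add (a b : K) : expNeg (a + b) = expNeg a * expNeg b := by
  rw [expNeg, neg_add, ← PowerSeries.exp_mul_exp_eq_exp_add]
  rfl

theorem expNeg_ne_one {a : K} (ha : a ≠ 0) : expNeg a ≠ 1 := by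
  intro h
  have hcoeff := congrArg (PowerSeries.coeff 1) h
  simp [expNeg, PowerSeries.coeff_rescale, PowerSeries.coeff_exp, PowerSeries.coeff_one, ha]
    at hcoeff

theorem rescale_map_oneSubMulExpNeg {F : Type*} [Field F] [Algebra ℚ F] (φ : F →+* K) (c : F)
    (a : K) : PowerSeries.rescale a (PowerSeries.map φ (oneSubMulExpNeg c)) =
      1 - PowerSeries.C (φ c) * expNeg a := by
  have hexp : PowerSeries.rescale a (PowerSeries.map φ (PowerSeries.evalNegHom
      (PowerSeries.exp F))) = expNeg a := by
    rw [expNeg, PowerSeries.evalNegHom, ← PowerSeries.rescale_map, PowerSeries.map_exp,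
      PowerSeries.rescale_rescale]
    simp
  have hconst : PowerSeries.rescale a (PowerSeries.C (φ c)) = PowerSeries.C (φ c) := by
    ext k
    rw [PowerSeries.coeff_rescale, PowerSeries.coeff_C]
    split_ifs with hk <;> simp [hk]
  rw [oneSubMulExpNeg, map_sub, map_sub, map_one, map_one, map_mul, map_mul, hexp,
    PowerSeries.map_C, hconst]

theorem rescale_map_toddFactor_mul {F : Type*} [Field F] [Algebra ℚ F] (φ : F →+* K) (c : F)
    (a : K) : PowerSeries.rescale a (PowerSeries.map φ (toddFactor c)) *
      (1 - PowerSeries.C (φ c) * expNeg a) = PowerSeries.C a * PowerSeries.X := by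
  rw [← rescale_map_oneSubMulExpNeg, ← map_mul, ← map_mul, toddFactor_mul, PowerSeries.map_X,
    PowerSeries.rescale_X]

/-- The character `u ↦ exp (-(∑ i, u_i x_i) t)` of `ℤ^ι` with values in Laurent series in `t`. -/
def expChar {ι : Type*} [Fintype ι] (x : ι → K) : Multiplicative (ι → ℤ) →* LaurentSeries K where
  toFun u := HahnSeries.ofPowerSeries ℤ K (expNeg (∑ i, u.toAdd i • x i))
  map_one' := by simp [expNeg_zero]
  map_mul' u v := by
    rw [← map_mul, ← expNeg_add, ← Finset.sum_add_distrib]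
    simp [add_mul]

theorem expChar_ofAdd_ne_one {ι : Type*} [Fintype ι] {x : ι → K} (hx : LinearIndependent ℤ x)
    (u : ι → ℤ) (hu : u ≠ 0) : expChar x (.ofAdd u) ≠ 1 := by
  have hsum : ∑ i, u i • x i ≠ 0 := fun h =>
    hu (funext (Fintype.linearIndependent_iff.1 hx u h))
  exact (map_ne_one_iff _ HahnSeries.ofPowerSeries_injective).2 (expNeg_ne_one hsum)

end ExpNeg

variable {K : Type*} [Field K] [Algebra ℚ K]

theorem inv_one_sub_algebraMap_mul_expNeg {F : Type*} [Field F] [Algebra ℚ F] [Algebra F K] (c : F)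
    {a : K} (ha : a ≠ 0) :
    (1 - algebraMap F (LaurentSeries K) c * HahnSeries.ofPowerSeries ℤ K (expNeg a))⁻¹ =
      HahnSeries.single (-1) a⁻¹ * HahnSeries.ofPowerSeries ℤ K
        (PowerSeries.rescale a (PowerSeries.map (algebraMap F K) (toddFactor c))) := by
  refine inv_eq_of_mul_eq_one_left ?_
  have h := congrArg (HahnSeries.ofPowerSeries ℤ K)
    (rescale_map_toddFactor_mul (algebraMap F K) c a)
  simp only [map_mul, map_sub, map_one, HahnSeries.ofPowerSeries_C, HahnSeries.ofPowerSeries_X]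
    at h
  rw [HahnSeries.algebraMap_apply', PowerSeries.algebraMap_apply, HahnSeries.ofPowerSeries_C,
    mul_assoc, h, HahnSeries.C_apply, HahnSeries.single_mul_single, HahnSeries.single_mul_single]
  simp [ha]

theorem prod_single {R ι : Type*} [CommSemiring R] [Fintype ι] (k : ℤ) (b : ι → R) :
    ∏ j, HahnSeries.single k (b j) = HahnSeries.single (Fintype.card ι • k) (∏ j, b j) := by
  have hfactor (l : ℤ) (r : R) :
      HahnSeries.single l r = HahnSeries.C r * HahnSeries.single l 1 := by
    rw [HahnSeries.C_apply, HahnSeries.single_mul_single, zero_add, mul_one]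
  rw [Finset.prod_congr rfl fun j _ => hfactor k (b j), Finset.prod_mul_distrib,
    Finset.prod_const, Finset.card_univ, ← map_prod, HahnSeries.single_pow, one_pow, ← hfactor]

theorem coeff_prod_inv_one_sub_mul_expNeg {F : Type*} [Field F] [Algebra ℚ F] [Algebra F K] {n : ℕ}
    (c : Fin n → F) {a : Fin n → K} (ha : ∀ j, a j ≠ 0) (N : ℕ) :
    (∏ j, (1 - algebraMap F (LaurentSeries K) (c j) *
      HahnSeries.ofPowerSeries ℤ K (expNeg (a j)))⁻¹).coeff (N - n) =
      MvPolynomial.aeval a (homogPart (∏ j, PowerSeries.subst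
        (MvPowerSeries.X j : MvPowerSeries (Fin n) F) (toddFactor (c j))) N) / ∏ j, a j := by
  simp only [inv_one_sub_algebraMap_mul_expNeg _ (ha _), Finset.prod_mul_distrib, ← map_prod,
    prod_single]
  rw [show (N - n : ℤ) = N + Fintype.card (Fin n) • (-1 : ℤ) by simp [sub_eq_add_neg],
    HahnSeries.coeff_single_mul_add, HahnSeries.ofPowerSeries_apply_coeff,
    aeval_homogPart_prod_subst, Finset.prod_inv_distrib, div_eq_inv_mul]

theorem coeff_prod_inv_one_sub_expChar {n : ℕ} {x : Fin n → K} (hx : LinearIndependent ℤ x)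
    {A : Matrix (Fin n) (Fin n) ℤ} (hA : A.det ≠ 0) (N : ℕ) :
    (∏ j, (1 - expChar x (.ofAdd (A.col j)))⁻¹).coeff (N - n) =
      MvPolynomial.aeval (fun j => ∑ i, A i j • x i) (homogPart (stdTodd n) N) /
        ∏ j, ∑ i, A i j • x i := by
  have hne (j : Fin n) : ∑ i, A i j • x i ≠ 0 := fun h =>
    hA (det_eq_zero_of_column_eq_zero j (Fintype.linearIndependent_iff.1 hx _ h))
  rw [stdTodd, ← coeff_prod_inv_one_sub_mul_expNeg (fun _ => (1 : ℚ)) hne]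
  simp only [map_one, one_mul]
  rfl

theorem SimplicialCone.coeff_sum_prod_inv_one_sub_char [Algebra ℂ K] {n : ℕ}
    (C : SimplicialCone n) {x : Fin n → K} (hx : ∀ j, x j ≠ 0) (N : ℕ) :
    (∑ γ : C.Gamma, ∏ j, (1 - algebraMap ℂ (LaurentSeries K) (C.char j γ) *
      expChar x (.ofAdd (Pi.single j 1)))⁻¹).coeff (N - n) =
      MvPolynomial.aeval x (C.toddPoly N) / ∏ j, x j := by
  have hsingle (j : Fin n) : expChar x (.ofAdd (Pi.single j 1)) =
      HahnSeries.ofPowerSeries ℤ K (expNeg (x j)) := by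
    simp [expChar, Pi.single_apply]
  simp only [hsingle, HahnSeries.coeff_sum]
  rw [toddPoly, todd, homogPart_sum, map_sum, Finset.sum_div]
  exact Finset.sum_congr rfl fun γ _ => coeff_prod_inv_one_sub_mul_expNeg (C.char · γ) hx N

theorem SimplicialCone.exists_aeval_toddPoly_eq [Algebra ℂ K] {n : ℕ} (C : SimplicialCone n)
    {x : Fin n → K} (hx : LinearIndependent ℤ x) (N : ℕ) :
    ∃ s ∈ AddSubgroup.closure {s : K | ∃ A : Matrix (Fin n) (Fin n) ℤ,
        A.det.natAbs = C.M.det.natAbs ∧ MvPolynomial.aeval (fun j => ∑ i, A i j • x i)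
          (homogPart (stdTodd n) N) / ∏ j, ∑ i, A i j • x i = s},
      MvPolynomial.aeval x (C.toddPoly N) = C.M.det.natAbs * (∏ j, x j) * s := by
  have hx0 (j : Fin n) : x j ≠ 0 := hx.ne_zero j
  obtain ⟨s, hs, hsum⟩ :=
    C.exists_sum_prod_inv_one_sub_char_eq_nsmul (z := expChar x) (expChar_ofAdd_ne_one hx)
  refine ⟨s.coeff (N - n), ?_, ?_⟩
  · have hmem := AddSubgroup.mem_map_of_mem (HahnSeries.coeff.addMonoidHom (N - n : ℤ)) hs
    rw [AddMonoidHom.map_closure] at hmem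
    refine AddSubgroup.closure_mono ?_ hmem
    rintro _ ⟨_, ⟨A, hA, rfl⟩, rfl⟩
    have hdet : A.det ≠ 0 := by
      rw [← Int.natAbs_ne_zero, hA]
      exact Int.natAbs_ne_zero.2 C.det_ne_zero
    exact ⟨A, hA, (coeff_prod_inv_one_sub_expChar hx hdet N).symm⟩
  · have hcoeff := congrArg (fun f : LaurentSeries K => f.coeff (N - n)) hsum
    simp only [C.coeff_sum_prod_inv_one_sub_char hx0, HahnSeries.coeff_nsmul, Pi.smul_apply]
      at hcoeff
    rw [(div_eq_iff (Finset.prod_ne_zero_iff.2 fun j _ => hx0 j)).1 hcoeff, C.card_Gamma,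
      nsmul_eq_mul]
    ring

end LaurentExpansion

section Gauss

variable {R σ : Type*} [CommRing R]

/-- A polynomial in several variables is primitive if its only constant divisors are units; for
one variable this is `Polynomial.IsPrimitive`. -/
def IsPrimitive (F : MvPolynomial σ R) : Prop := ∀ c : R, MvPolynomial.C c ∣ F → IsUnit c

theorem isPrimitive_one : IsPrimitive (1 : MvPolynomial σ R) := fun c hc => by
  simpa [isUnit_iff_dvd_one] using (MvPolynomial.C_dvd_iff_dvd_coeff c _).1 hc 0

theorem IsPrimitive.ne_zero [Nontrivial R] {F : MvPolynomial σ R} (hF : IsPrimitive F) : F ≠ 0 := by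
  rintro rfl
  exact not_isUnit_zero (hF 0 (dvd_zero _))

section UniqueFactorization

variable [IsDomain R] [UniqueFactorizationMonoid R]

theorem IsPrimitive.mul {F G : MvPolynomial σ R} (hF : IsPrimitive F) (hG : IsPrimitive G) :
    IsPrimitive (F * G) := by
  intro c hc
  by_contra hunit
  have hc0 : c ≠ 0 := by
    rintro rfl
    rw [map_zero, zero_dvd_iff] at hc
    exact mul_ne_zero hF.ne_zero hG.ne_zero hc
  obtain ⟨p, hp, hpc⟩ := WfDvdMonoid.exists_irreducible_factor hunit hc0
  have hpC : Prime (MvPolynomial.C p : MvPolynomial σ R) := (MvPolynomial.prime_C_iff σ).2 hp.prime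
  exact (hpC.dvd_or_dvd ((map_dvd MvPolynomial.C hpc).trans hc)).elim
    (fun h => hp.not_isUnit (hF p h)) fun h => hp.not_isUnit (hG p h)

theorem isPrimitive_prod {ι : Type*} (s : Finset ι) {F : ι → MvPolynomial σ R}
    (h : ∀ i ∈ s, IsPrimitive (F i)) : IsPrimitive (∏ i ∈ s, F i) :=
  Finset.prod_induction F IsPrimitive (fun _ _ => IsPrimitive.mul) isPrimitive_one h

theorem IsPrimitive.C_dvd_of_C_dvd_mul {F : MvPolynomial σ R} (hF : IsPrimitive F) {d : R}
    (hd : d ≠ 0) {G : MvPolynomial σ R} (h : MvPolynomial.C d ∣ G * F) : MvPolynomial.C d ∣ G := by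
  induction d using UniqueFactorizationMonoid.induction_on_prime generalizing G with
  | h₁ => exact absurd rfl hd
  | h₂ a ha => exact (ha.map MvPolynomial.C).dvd
  | h₃ a p ha hp ih =>
    have hpC : Prime (MvPolynomial.C p : MvPolynomial σ R) := (MvPolynomial.prime_C_iff σ).2 hp
    rw [map_mul] at h ⊢
    obtain ⟨G', rfl⟩ := (hpC.dvd_or_dvd ((dvd_mul_right _ _).trans h)).resolve_right
      fun hpF => hp.not_isUnit (hF p hpF)
    rw [mul_assoc, mul_dvd_mul_iff_left hpC.ne_zero] at h
    exact mul_dvd_mul_left _ (ih ha h)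

attribute [local instance] MvPolynomial.algebraMvPolynomial

theorem IsPrimitive.dvd_of_fraction_map_dvd_fraction_map {K : Type*} [Field K] [Algebra R K]
    [IsFractionRing R K] {F P : MvPolynomial σ R} (hF : IsPrimitive F)
    (h : MvPolynomial.map (algebraMap R K) F ∣ MvPolynomial.map (algebraMap R K) P) : F ∣ P := by
  obtain ⟨G, hG⟩ := h
  obtain ⟨⟨G', ⟨_, d, hd, rfl⟩⟩, hG'⟩ :=
    IsLocalization.surj ((nonZeroDivisors R).map (MvPolynomial.C (σ := σ))) G
  have hd0 : d ≠ 0 := nonZeroDivisors.ne_zero hd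
  have hmul : G' * F = MvPolynomial.C d * P := by
    apply MvPolynomial.map_injective _ (IsFractionRing.injective R K)
    rw [map_mul, map_mul, hG]
    simp only [MvPolynomial.algebraMap_def] at hG'
    rw [← hG']
    ring
  obtain ⟨Q, rfl⟩ := hF.C_dvd_of_C_dvd_mul hd0 ⟨P, hmul⟩
  rw [mul_assoc] at hmul
  exact ⟨Q, by rw [mul_comm F, mul_left_cancel₀ (MvPolynomial.C_ne_zero.2 hd0) hmul]⟩

theorem dvd_of_map_dvd_map {K L : Type*} [Field K] [Field L] [Algebra K L]
    {F P : MvPolynomial σ K}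
    (h : MvPolynomial.map (algebraMap K L) F ∣ MvPolynomial.map (algebraMap K L) P) : F ∣ P := by
  have : Module.FaithfullyFlat (MvPolynomial σ K) (MvPolynomial σ L) :=
    .of_linearEquiv _ _ (Algebra.IsPushout.equiv K (MvPolynomial σ K) L
      (MvPolynomial σ L)).symm.toLinearEquiv
  rw [← Ideal.mem_span_singleton,
    ← Ideal.comap_map_eq_self_of_faithfullyFlat (B := MvPolynomial σ L) (Ideal.span {F}),
    Ideal.mem_comap, Ideal.map_span, Set.image_singleton, Ideal.mem_span_singleton]
  exact h

theorem IsPrimitive.dvd_of_map_dvd_map {L : Type*} [Field L] [Algebra R L] [FaithfulSMul R L]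
    {F P : MvPolynomial σ R} (hF : IsPrimitive F)
    (h : MvPolynomial.map (algebraMap R L) F ∣ MvPolynomial.map (algebraMap R L) P) : F ∣ P := by
  let := FractionRing.liftAlgebra R L
  refine hF.dvd_of_fraction_map_dvd_fraction_map (K := FractionRing R)
    (ToddCone.dvd_of_map_dvd_map (L := L) ?_)
  rwa [MvPolynomial.map_map, MvPolynomial.map_map, ← IsScalarTower.algebraMap_eq]

/-- The quotients `P / F` in `K` of polynomials over `R` with `F` primitive, where polynomials are
mapped to `K` by `f`. -/
def primitiveQuotients {K : Type*} [CommRing K] (f : MvPolynomial σ R →+* K) : AddSubgroup K where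
  carrier := {k | ∃ P F, IsPrimitive F ∧ k * f F = f P}
  zero_mem' := ⟨0, 1, isPrimitive_one, by simp⟩
  add_mem' := by
    rintro k l ⟨P, F, hF, h⟩ ⟨Q, G, hG, h'⟩
    refine ⟨P * G + Q * F, F * G, hF.mul hG, ?_⟩
    rw [map_add, map_mul, map_mul, map_mul, ← h, ← h']
    ring
  neg_mem' := by
    rintro k ⟨P, F, hF, h⟩
    exact ⟨-P, F, hF, by rw [neg_mul, h, map_neg]⟩

theorem exists_map_eq_of_algebraMap_mem_primitiveQuotients {K L : Type*} [Field L] [Algebra R L]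
    [FaithfulSMul R L] [CommRing K] [Algebra (MvPolynomial σ L) K]
    [FaithfulSMul (MvPolynomial σ L) K] {G : MvPolynomial σ L}
    (h : algebraMap _ K G ∈ primitiveQuotients
      ((algebraMap (MvPolynomial σ L) K).comp (MvPolynomial.map (algebraMap R L)))) :
    ∃ P, MvPolynomial.map (algebraMap R L) P = G := by
  obtain ⟨P, F, hF, h⟩ := h
  rw [RingHom.comp_apply, RingHom.comp_apply, ← map_mul] at h
  replace h := FaithfulSMul.algebraMap_injective _ _ h
  obtain ⟨Q, rfl⟩ := hF.dvd_of_map_dvd_map (L := L) (h ▸ dvd_mul_left _ _)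
  rw [map_mul, mul_comm] at h
  have hF0 : MvPolynomial.map (algebraMap R L) F ≠ 0 :=
    (map_ne_zero_iff _ (MvPolynomial.map_injective _ (FaithfulSMul.algebraMap_injective R L))).2
      hF.ne_zero
  exact ⟨Q, (mul_left_cancel₀ hF0 h).symm⟩

end UniqueFactorization

variable [Fintype σ]

/-- The linear form with coefficient vector `a`. -/
def linForm (a : σ → R) : MvPolynomial σ R := ∑ i, a i • MvPolynomial.X i

theorem coeff_linForm (a : σ → R) (i : σ) :
    MvPolynomial.coeff (Finsupp.single i 1) (linForm a) = a i := by
  classical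
  simp [linForm, MvPolynomial.coeff_sum, MvPolynomial.coeff_X, Finsupp.single_left_inj]

theorem linForm_smul (c : R) (a : σ → R) : linForm (c • a) = MvPolynomial.C c * linForm a := by
  simp [linForm, Finset.smul_sum, MvPolynomial.C_mul', smul_smul]

theorem exists_eq_smul_isPrimitive_linForm [IsDomain R] [IsGCDMonoid R] {a : σ → R}
    (ha : a ≠ 0) : ∃ (c : R) (b : σ → R), a = c • b ∧ IsPrimitive (linForm b) := by
  let := Classical.arbitrary (NormalizedGCDMonoid R)
  obtain ⟨i, -⟩ := Function.ne_iff.1 ha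
  obtain ⟨b, hb, hb1⟩ := Finset.extract_gcd a ⟨i, Finset.mem_univ i⟩
  refine ⟨Finset.univ.gcd a, b, funext fun i => hb i (Finset.mem_univ i), fun c hc => ?_⟩
  refine isUnit_of_dvd_one (hb1 ▸ Finset.dvd_gcd fun i _ => ?_)
  rw [← coeff_linForm b i]
  exact (MvPolynomial.C_dvd_iff_dvd_coeff _ _).1 hc _

/-- Pulling the content out of each column shows that the product of the contents divides the
determinant. -/
theorem div_prod_linForm_col_mem_primitiveQuotients [IsDomain R] [UniqueFactorizationMonoid R]
    [DecidableEq σ] {K : Type*} [Field K] {f : MvPolynomial σ R →+* K}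
    (hf : Function.Injective f) {A : Matrix σ σ R} (hA : A.det ≠ 0) {d : R} (hd : A.det ∣ d)
    (P : MvPolynomial σ R) :
    f (MvPolynomial.C d * P) / ∏ j, f (linForm (A.col j)) ∈ primitiveQuotients f := by
  have hcol (j : σ) : A.col j ≠ 0 := fun h => hA (det_eq_zero_of_column_eq_zero j (congrFun h))
  choose c b hcb hb using fun j => exists_eq_smul_isPrimitive_linForm (hcol j)
  have hdet : A.det = (∏ j, c j) * (of b)ᵀ.det := by
    rw [mul_comm, ← det_diagonal, ← det_mul]
    congr 1
    ext i j
    rw [mul_diagonal, mul_comm]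
    exact congrFun (hcb j) i
  have hc : ∏ j, c j ≠ 0 := left_ne_zero_of_mul (hdet ▸ hA)
  obtain ⟨e, rfl⟩ : ∏ j, c j ∣ d := (Dvd.intro _ hdet.symm).trans hd
  have hprod : ∏ j, linForm (A.col j) = MvPolynomial.C (∏ j, c j) * ∏ j, linForm (b j) := by
    rw [map_prod, ← Finset.prod_mul_distrib]
    exact Finset.prod_congr rfl fun j _ => by rw [hcb, linForm_smul]
  have hprim : IsPrimitive (∏ j, linForm (b j)) := isPrimitive_prod _ fun j _ => hb j
  have hfc : f (MvPolynomial.C (∏ j, c j)) ≠ 0 :=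
    (map_ne_zero_iff f hf).2 (MvPolynomial.C_ne_zero.2 hc)
  have hfb : f (∏ j, linForm (b j)) ≠ 0 := (map_ne_zero_iff f hf).2 hprim.ne_zero
  refine ⟨MvPolynomial.C e * P, _, hprim, ?_⟩
  rw [← map_prod, hprod, map_mul f (MvPolynomial.C (∏ j, c j)), div_mul_eq_mul_div,
    mul_div_mul_right _ _ hfb, div_eq_iff hfc, ← map_mul]
  congr 1
  rw [map_mul MvPolynomial.C]
  ring

end Gauss

section Integrality

variable {n : ℕ}

theorem toddDenom_ne_zero (N n : ℕ) : toddDenom N n ≠ 0 := by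
  rw [toddDenom, Ne, Finset.lcm_eq_zero_iff]
  rintro ⟨r, _, h⟩
  exact Rat.den_ne_zero _ h

theorem exists_map_eq_toddDenom_mul_homogPart (N n : ℕ) : ∃ H : MvPolynomial (Fin n) ℤ,
    MvPolynomial.map (algebraMap ℤ ℚ) H =
      MvPolynomial.C (toddDenom N n : ℚ) * homogPart (stdTodd n) N := by
  refine MvPolynomial.mem_range_map_iff_coeffs_subset.2 fun a ha => ?_
  obtain ⟨r, hr, rfl⟩ := MvPolynomial.mem_coeffs_iff.1 ha
  rw [MvPolynomial.coeff_C_mul]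
  set b := MvPolynomial.coeff r (homogPart (stdTodd n) N)
  have hr' : r ∈ (homogPart (stdTodd n) N).support := by
    rw [MvPolynomial.mem_support_iff, MvPolynomial.coeff_C_mul] at hr
    exact MvPolynomial.mem_support_iff.2 (right_ne_zero_of_mul hr)
  obtain ⟨e, he⟩ : b.den ∣ toddDenom N n := Finset.dvd_lcm hr'
  refine ⟨e * b.num, ?_⟩
  rw [he, algebraMap_int_eq, eq_intCast]
  push_cast
  rw [← Rat.den_mul_eq_num]
  ring

variable {K : Type*} [Field K] [Algebra ℚ K] {f : MvPolynomial (Fin n) ℤ →+* K}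

theorem mul_aeval_div_prod_mem_primitiveQuotients (hf : Function.Injective f)
    {A : Matrix (Fin n) (Fin n) ℤ} (hA : A.det ≠ 0) {d : ℕ} (hd : A.det ∣ d) (N : ℕ) :
    toddDenom N n * (d * ∏ i, f (MvPolynomial.X i)) *
      (MvPolynomial.aeval (fun j => ∑ i, A i j • f (MvPolynomial.X i)) (homogPart (stdTodd n) N) /
        ∏ j, ∑ i, A i j • f (MvPolynomial.X i)) ∈ primitiveQuotients f := by
  obtain ⟨H, hH⟩ := exists_map_eq_toddDenom_mul_homogPart N n
  have hlin (j : Fin n) : ∑ i, A i j • f (MvPolynomial.X i) = f (linForm (A.col j)) :=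
    by simp only [linForm, map_sum, map_zsmul, Matrix.col_apply]
  have haeval : toddDenom N n * MvPolynomial.aeval (fun j => f (linForm (A.col j)))
      (homogPart (stdTodd n) N) = f (MvPolynomial.aeval (fun j => linForm (A.col j)) H) := by
    have h := congrArg (MvPolynomial.aeval fun j => f (linForm (A.col j))) hH
    rw [map_mul, MvPolynomial.aeval_C, map_natCast] at h
    rw [← h, MvPolynomial.aeval_map_algebraMap, MvPolynomial.aeval_def, MvPolynomial.aeval_def,
      MvPolynomial.hom_eval₂]
    exact congrArg (MvPolynomial.eval₂ · _ _) (RingHom.ext_int _ _)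
  simp only [hlin]
  convert div_prod_linForm_col_mem_primitiveQuotients hf hA hd
    ((∏ i, MvPolynomial.X i) * MvPolynomial.aeval (fun j => linForm (A.col j)) H) using 1
  rw [map_mul, map_mul, ← haeval, map_prod, map_natCast MvPolynomial.C,
    map_natCast f]
  ring

theorem SimplicialCone.toddDenom_mul_aeval_toddPoly_mem_primitiveQuotients [Algebra ℂ K]
    (C : SimplicialCone n) (hf : Function.Injective f) (N : ℕ) :
    toddDenom N n * MvPolynomial.aeval (fun i => f (MvPolynomial.X i)) (C.toddPoly N) ∈
      primitiveQuotients f := by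
  have hX : LinearIndependent ℤ fun i => f (MvPolynomial.X i) :=
    (MvPolynomial.linearIndependent_X (Fin n) ℤ).map' f.toAddMonoidHom.toIntLinearMap
      (LinearMap.ker_eq_bot.2 hf)
  obtain ⟨s, hs, hsum⟩ := C.exists_aeval_toddPoly_eq hX N
  rw [hsum, ← mul_assoc]
  suffices h : AddSubgroup.closure _ ≤ (primitiveQuotients f).comap (AddMonoidHom.mulLeft _) from
    h hs
  rw [AddSubgroup.closure_le]
  rintro _ ⟨A, hA, rfl⟩
  refine mul_aeval_div_prod_mem_primitiveQuotients hf ?_ (hA ▸ Int.dvd_natAbs.2 dvd_rfl) N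
  rw [← Int.natAbs_ne_zero, hA]
  exact Int.natAbs_ne_zero.2 C.det_ne_zero

theorem SimplicialCone.exists_toddPoly_eq (C : SimplicialCone n) (N : ℕ) :
    ∃ P : MvPolynomial (Fin n) ℤ, C.toddPoly N =
      MvPolynomial.C (1 / (toddDenom N n : ℂ)) * MvPolynomial.map (Int.castRingHom ℂ) P := by
  let f : MvPolynomial (Fin n) ℤ →+* FractionRing (MvPolynomial (Fin n) ℂ) :=
    (algebraMap (MvPolynomial (Fin n) ℂ) _).comp (MvPolynomial.map (algebraMap ℤ ℂ))
  have hf : Function.Injective f :=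
    (FaithfulSMul.algebraMap_injective (MvPolynomial (Fin n) ℂ) _).comp
      (MvPolynomial.map_injective _ (algebraMap ℤ ℂ).injective_int)
  have hmem : algebraMap _ (FractionRing (MvPolynomial (Fin n) ℂ))
      (MvPolynomial.C (toddDenom N n : ℂ) * C.toddPoly N) ∈ primitiveQuotients f := by
    convert C.toddDenom_mul_aeval_toddPoly_mem_primitiveQuotients hf N using 1
    have hX (i : Fin n) : f (MvPolynomial.X i) =
        algebraMap (MvPolynomial (Fin n) ℂ) _ (MvPolynomial.X i) := by simp [f]
    have haeval : MvPolynomial.aeval (fun i => algebraMap (MvPolynomial (Fin n) ℂ)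
        (FractionRing (MvPolynomial (Fin n) ℂ)) (MvPolynomial.X i)) (C.toddPoly N) =
        algebraMap _ _ (C.toddPoly N) :=
      (MvPolynomial.aeval_algebraMap_apply _ _ _).trans
        (congrArg _ (MvPolynomial.aeval_X_left_apply _))
    simp only [hX, haeval, map_mul, map_natCast]
  obtain ⟨P, hP⟩ := exists_map_eq_of_algebraMap_mem_primitiveQuotients hmem
  refine ⟨P, ?_⟩
  rw [← algebraMap_int_eq, hP, ← mul_assoc, ← map_mul, one_div_mul_cancel
    (Nat.cast_ne_zero.2 (toddDenom_ne_zero N n)), map_one, one_mul]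

end Integrality

section Coordinates

namespace SimplicialCone

variable {n : ℕ} (C : SimplicialCone n)

theorem polyInBasis_dualGen (i : Fin n) : C.polyInBasis (C.dualGen i) = MvPolynomial.X i := by
  have hgen (l : Fin n) : ∑ k, C.MC⁻¹ i k * ((C.gen l k : ℤ) : ℂ) = if i = l then 1 else 0 :=
    C.coord_gen l i
  simp only [dualGen, map_sum, map_mul, polyInBasis, MvPolynomial.aeval_X, MvPolynomial.aeval_C,
    MvPolynomial.algebraMap_eq, Finset.mul_sum]
  rw [Finset.sum_comm]
  simp only [← mul_assoc, ← map_mul, ← Finset.sum_mul, ← map_sum, hgen]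
  simp

theorem polyInBasis_T (N : ℕ) : C.polyInBasis (C.T N) = C.toddPoly N := by
  simp only [T, MvPolynomial.comp_aeval_apply, polyInBasis_dualGen,
    MvPolynomial.aeval_X_left_apply]

theorem inBasis_algebraMap (f : MvPolynomial (Fin n) ℂ) :
    C.inBasis (algebraMap _ (FractionRing (MvPolynomial (Fin n) ℂ)) f) =
      algebraMap _ (FractionRing (MvPolynomial (Fin n) ℂ)) (C.polyInBasis f) := by
  rw [inBasis, IsFractionRing.map, IsLocalization.map_eq]
  rfl

theorem algebraMap_toddPoly_eq (N : ℕ) :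
    algebraMap (MvPolynomial (Fin n) ℂ) (FractionRing (MvPolynomial (Fin n) ℂ)) (C.toddPoly N) =
      algebraMap (MvPolynomial (Fin n) ℂ) (FractionRing (MvPolynomial (Fin n) ℂ))
        (MvPolynomial.C (C.M.det : ℂ) * ∏ i, MvPolynomial.X i) * C.inBasis (C.S N) := by
  have hC : C.polyInBasis (MvPolynomial.C (C.M.det : ℂ)) = MvPolynomial.C (C.M.det : ℂ) :=
    C.polyInBasis.commutes _
  have hne : algebraMap (MvPolynomial (Fin n) ℂ) (FractionRing (MvPolynomial (Fin n) ℂ))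
      (MvPolynomial.C (C.M.det : ℂ) * ∏ i, MvPolynomial.X i) ≠ 0 := by
    rw [map_ne_zero_iff _ (FaithfulSMul.algebraMap_injective _ _)]
    refine mul_ne_zero (MvPolynomial.C_ne_zero.2 (Int.cast_ne_zero.2 C.det_ne_zero))
      (Finset.prod_ne_zero_iff.2 fun i _ => MvPolynomial.X_ne_zero i)
  rw [S, map_div₀, inBasis_algebraMap, inBasis_algebraMap, polyInBasis_T, map_mul C.polyInBasis,
    hC, map_prod C.polyInBasis]
  simp only [polyInBasis_dualGen]
  rw [mul_div_cancel₀ _ hne]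

end SimplicialCone

end Coordinates

end ToddCone

end

theorem mainTheorem4_general {n : ℕ} (C : ToddCone.SimplicialCone n) (N : ℕ) :
    algebraMap (MvPolynomial (Fin n) ℂ) (FractionRing (MvPolynomial (Fin n) ℂ)) (C.toddPoly N) =
      algebraMap (MvPolynomial (Fin n) ℂ) (FractionRing (MvPolynomial (Fin n) ℂ))
        (MvPolynomial.C (C.M.det : ℂ) * ∏ i, MvPolynomial.X i) * C.inBasis (C.S N) ∧
    ∃ P : MvPolynomial (Fin n) ℤ, C.toddPoly N =
      MvPolynomial.C (1 / (ToddCone.toddDenom N n : ℂ)) *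
        MvPolynomial.map (Int.castRingHom ℂ) P :=
  ⟨C.algebraMap_toddPoly_eq N, C.exists_toddPoly_eq N⟩

theorem mainTheorem4 (m N q : ℕ) (p : Fin m → ℕ) (hq : 0 < q)
    (hp : ∀ i, 0 < p i ∧ p i < q ∧ Nat.Coprime (p i) q) :
    algebraMap (MvPolynomial (Fin (m + 1)) ℂ) (FractionRing (MvPolynomial (Fin (m + 1)) ℂ))
        ((ToddCone.dedekindCone q hq p).toddPoly N) =
      algebraMap (MvPolynomial (Fin (m + 1)) ℂ) (FractionRing (MvPolynomial (Fin (m + 1)) ℂ))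
        (MvPolynomial.C (q : ℂ) * ∏ i, MvPolynomial.X i) *
        (ToddCone.dedekindCone q hq p).inBasis ((ToddCone.dedekindCone q hq p).S N) ∧
    ∃ P : MvPolynomial (Fin (m + 1)) ℤ,
      (ToddCone.dedekindCone q hq p).toddPoly N =
        MvPolynomial.C (1 / (ToddCone.toddDenom N (m + 1) : ℂ)) *
          MvPolynomial.map (Int.castRingHom ℂ) P := by
  have hdet : (ToddCone.dedekindCone q hq p).M.det = (q : ℤ) := ToddCone.det_dedekindGen q p
  simpa only [hdet, Int.cast_natCast] using mainTheorem4_general (ToddCone.dedekindCone q hq p) N
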